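/- Let $\mathcal S,\mathcal A,\mathcal B,\mathcal E$ be finite sets, let $Q_S$ be a probability distribution on $\mathcal S$ (law of the channel state), let $W_{BE|AS}$ be a channel from $\mathcal A\times\mathcal S$ to $\mathcal B\times\mathcal E$, and let $\phi_0$ be a probability distribution on $\mathcal A$ (law of the innocent input when there is no communication; a point mass if it is a fixed symbol). Put $Q_0(e)=\sum_{s,a,b}Q_S(s)\,\phi_0(a)\,W_{BE|AS}(b,e|a,s)$, the law of one output of the warden when there is no communication. All logarithms are to base $2$. A $(2^{nR},2^{nR_K},n)$ code, with the state known non-causally at both transmitter and receiver, consists of a stochastic encoder, which maps a message $m\in\mathcal M_n=\{1,\dots,\lfloor 2^{nR}\rfloor\}$ and the state sequence $s^n$ to a channel input $A^n$ and a key $K\in\mathcal K_n=\{1,\dots,\lfloor 2^{nR_K}\rfloor\}$, and a stochastic decoder, which maps the channel output $b^n$ and the state sequence $s^n$ to an estimate $(\hat M,\hat K)\in\mathcal M_n\times\mathcal K_n$. The message $M$ is uniform on $\mathcal M_n$, the state sequence $S^n$ is i.i.d. with law $Q_S$ and independent of $M$, and $(B^n,E^n)$ is the output of $n$ memoryless uses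 of $W_{BE|AS}$ with input $A^n$ and state $S^n$. A pair $(R,R_K)$ with $R,R_K\ge 0$ is achievable if there is a sequence of $(2^{nR},2^{nR_K},n)$ codes such that, as $n\to\infty$, $$\mathbb P\{(\hat M,\hat K)\neq(M,K)\}\to 0\qquad\text{and}\qquad \big\|P_{KE^n}-\mathrm{Unif}(\mathcal K_n)\times Q_0^{\times n}\big\|_{TV}\to 0 .$$ The covert secret key capacity $C_{CSK}$ is the supremum of all $R_K\ge 0$ for which $(R,R_K)$ is achievable for some $R\ge 0$. **Theorem.** The covert secret key capacity is $$C_{CSK}=\sup_{P_{SUABE}\in\mathcal D}\{I(U;B|S)-I(U;E|S)+H(S|E)\},$$ where $\mathcal D$ is the set of all joint distributions of the form $P_{SUABE}=Q_S\,P_{U|S}\,P_{A|US}\,W_{BE|AS}$, with an auxiliary random variable $U$ on an arbitrary finite alphabet, such that $P_E=Q_0$. Both suprema are over non-empty sets of real numbers that are bounded above. -/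

import Mathlib

open Filter Topology

noncomputable section

namespace CovertKey

section Information

/-! Shannon information measures, in bits, of random variables on a finite sample space.
A probability mass function on a finite type `α` is an element of `stdSimplex ℝ α`. -/

variable {Ω α β γ : Type*} [Fintype Ω]

open Classical in
/-- The law of the random variable `X` when the sample point has probability mass function `p`. -/
def law (p : Ω → ℝ) (X : Ω → α) (x : α) : ℝ :=
  ∑ ω, if X ω = x then p ω else 0

variable [Fintype α] [Fintype β] [Fintype γ]

/-- The Shannon entropy `H(X) = -∑ x, P(x) log₂ P(x)`, with `0 log 0 = 0`. -/
def entropy (p : Ω → ℝ) (X : Ω → α) : ℝ :=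
  -∑ x, law p X x * Real.logb 2 (law p X x)

/-- The conditional entropy `H(X|Y) = H(X,Y) - H(Y)`. -/
def condEntropy (p : Ω → ℝ) (X : Ω → α) (Y : Ω → β) : ℝ :=
  entropy p (fun ω => (X ω, Y ω)) - entropy p Y

/-- The conditional mutual information `I(X;Y|Z) = H(X|Z) - H(X|Y,Z)`. -/
def condMutualInfo (p : Ω → ℝ) (X : Ω → α) (Y : Ω → β) (Z : Ω → γ) : ℝ :=
  condEntropy p X Z - condEntropy p X (fun ω => (Y ω, Z ω))

/-- The total variation distance of two probability mass functions. -/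
def tvDist (p q : α → ℝ) : ℝ :=
  (1 / 2) * ∑ x, |p x - q x|

end Information

/-- A classical state-dependent discrete memoryless channel with state alphabet `S`, input
alphabet `A`, output alphabet `B` of the receiver and output alphabet `E` of the warden,
together with the law of the state and the law of the input in the no-communication mode
(a point mass if the innocent input is a fixed symbol). -/
structure StateChannel (S A B E : Type*) [Fintype S] [Fintype A] [Fintype B] [Fintype E] where
  /-- The law of one channel state. -/
  QS : S → ℝ
  QS_mem : QS ∈ stdSimplex ℝ S
  /-- The transition law: `W a s (b, e)` is the probability of the outputs `b`, `e`
  for the input `a` and the state `s`. -/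
  W : A → S → B × E → ℝ
  W_mem : ∀ a s, W a s ∈ stdSimplex ℝ (B × E)
  /-- The law of the innocent channel input. -/
  innocent : A → ℝ
  innocent_mem : innocent ∈ stdSimplex ℝ A

/-- A code of length `n` with `M` messages and `K` key values, the state sequence being known
non-causally at both ends. The stochastic encoder maps a message and the whole state sequence to
a channel input sequence and a key; the stochastic decoder maps the channel output sequence and
the whole state sequence to estimates of the message and of the key. -/
structure Code (S A B : Type*) [Fintype S] [Fintype A] [Fintype B] (n M K : ℕ) where
  /-- `enc m s (a, k)` is the probability of sending `a` and forming the key `k`. -/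
  enc : Fin M → (Fin n → S) → (Fin n → A) × Fin K → ℝ
  enc_mem : ∀ m s, enc m s ∈ stdSimplex ℝ ((Fin n → A) × Fin K)
  /-- `dec b s (m, k)` is the probability of announcing the message `m` and the key `k`. -/
  dec : (Fin n → B) → (Fin n → S) → Fin M × Fin K → ℝ
  dec_mem : ∀ b s, dec b s ∈ stdSimplex ℝ (Fin M × Fin K)

namespace StateChannel

variable {S A B E : Type*} [Fintype S] [Fintype A] [Fintype B] [Fintype E]

/-- The law `Q₀` of one output of the warden in the no-communication mode. -/
def wardenInnocent (C : StateChannel S A B E) (e : E) : ℝ :=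
  ∑ s, ∑ a, ∑ b, C.QS s * C.innocent a * C.W a s (b, e)

section Operational

variable {n M K : ℕ}

/-- The joint law of the message (uniform), the state sequence (i.i.d.), the input sequence, the
key and the two output sequences (memoryless channel) that a code induces. -/
def codeLaw (C : StateChannel S A B E) (c : Code S A B n M K) (m : Fin M) (s : Fin n → S)
    (a : Fin n → A) (k : Fin K) (b : Fin n → B) (e : Fin n → E) : ℝ :=
  (1 / (M : ℝ)) * (∏ i, C.QS (s i)) * c.enc m s (a, k) * ∏ i, C.W (a i) (s i) (b i, e i)

/-- The probability that the decoded pair differs from the pair of message and key. -/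
def errorProb (C : StateChannel S A B E) (c : Code S A B n M K) : ℝ :=
  ∑ m, ∑ s, ∑ a, ∑ k, ∑ b, ∑ e, ∑ d : Fin M × Fin K,
    if d ≠ (m, k) then C.codeLaw c m s a k b e * c.dec b s d else 0

/-- The joint law of the key and of the output sequence of the warden that a code induces. -/
def keyWardenLaw (C : StateChannel S A B E) (c : Code S A B n M K)
    (x : Fin K × (Fin n → E)) : ℝ :=
  ∑ m, ∑ s, ∑ a, ∑ b, C.codeLaw c m s a x.1 b x.2

/-- The ideal joint law: a uniform key, independent of an output sequence of the warden that is
distributed as if there were no communication. -/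
def idealKeyWardenLaw (C : StateChannel S A B E) (n K : ℕ) (x : Fin K × (Fin n → E)) : ℝ :=
  (1 / (K : ℝ)) * ∏ i, C.wardenInnocent (x.2 i)

/-- The pair `(R, RK)` of a message rate and a key rate is achievable if there are codes of all
lengths `n` with `⌊2^(nR)⌋` messages and `⌊2^(nRK)⌋` key values such that the error probability
vanishes and the joint law of the key and the warden's outputs approaches the ideal one. -/
def Achievable (C : StateChannel S A B E) (R RK : ℝ) : Prop :=
  0 ≤ R ∧ 0 ≤ RK ∧
    ∃ c : ∀ n : ℕ, Code S A B n ⌊(2 : ℝ) ^ ((n : ℝ) * R)⌋₊ ⌊(2 : ℝ) ^ ((n : ℝ) * RK)⌋₊,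
      Tendsto (fun n => C.errorProb (c n)) atTop (𝓝 0) ∧
      Tendsto (fun n => tvDist (C.keyWardenLaw (c n)) (C.idealKeyWardenLaw n _)) atTop (𝓝 0)

/-- The achievable covert secret key rates. -/
def achievableKeyRates (C : StateChannel S A B E) : Set ℝ :=
  {RK | ∃ R, C.Achievable R RK}

/-- The covert secret key capacity: the supremum of all achievable covert secret key rates. -/
def covertKeyCapacity (C : StateChannel S A B E) : ℝ :=
  sSup C.achievableKeyRates

end Operational

section SingleLetter

variable {U : Type*} [Fintype U]

/-- The joint laws `P = Q_S P_{U|S} P_{A|US} W_{BE|AS}` with `P_E = Q₀`, for an auxiliary variable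
with values in the finite set `U`. -/
def covertLaws (C : StateChannel S A B E) (U : Type*) [Fintype U] :
    Set (S × U × A × B × E → ℝ) :=
  {P | (∃ (PU : S → U → ℝ) (PA : U → S → A → ℝ),
      (∀ s, PU s ∈ stdSimplex ℝ U) ∧ (∀ u s, PA u s ∈ stdSimplex ℝ A) ∧
      ∀ s u a b e, P (s, u, a, b, e) = C.QS s * PU s u * PA u s a * C.W a s (b, e)) ∧
    law P (fun ω => ω.2.2.2.2) = C.wardenInnocent}

/-- The value `I(U;B|S) - I(U;E|S) + H(S|E)`, in bits, under the joint law `P`. -/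
def keyRate (P : S × U × A × B × E → ℝ) : ℝ :=
  condMutualInfo P (fun ω => ω.2.1) (fun ω => ω.2.2.2.1) (fun ω => ω.1)
    - condMutualInfo P (fun ω => ω.2.1) (fun ω => ω.2.2.2.2) (fun ω => ω.1)
    + condEntropy P (fun ω => ω.1) (fun ω => ω.2.2.2.2)

/-- All the values of `keyRate`; the auxiliary variable ranges over all finite alphabets. -/
def keyRateValues (C : StateChannel S A B E) : Set ℝ :=
  {x | ∃ N : ℕ, ∃ P ∈ C.covertLaws (Fin N), x = keyRate P}

end SingleLetter

end StateChannel

end CovertKey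

end

/-!
Write `X = (B, S)` for what the receiver sees. Since the state is known at both ends, the
single-letter rate is `H(U,S|E) - H(U|B,S)`, that is
`H(U,S,E) - H(U,B,S) + H(B,S) - H(E)` (`keyRate_eq_entropies`).

*The region.* The first difference is a sum over `u` of a positively homogeneous continuous function
of the unnormalised law of `(S, A)` given `U = u`, and the second one depends on the law of `(S, A)`
only. Hence the rates are the values of one continuous function on a slice of the convex hull of a
compact graph (`mem_keyRateValues_iff`). By Carathéodory's theorem that hull is compact, whatever
the size of the auxiliary alphabet, so the region is bounded and laws that meet the covertness
constraint only approximately can be replaced by a limit that meets it exactly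
(`le_sSup_keyRateValues_of_approx`).

*Converse.* Take `U i = (K, X 1, …, X (i-1), E (i+1), …, E n)`. Passing from `E` to `X` one letter
at a time, the differences `H(U i, E i) - H(U i, X i)` telescope to `H(K, E^n) - H(K, X^n)`
(`entropy_sub_le_sum_letterRate`). Fano's inequality gives `H(K, X^n) ≈ H(X^n) ≤ ∑ i, H(X i)`, and
closeness to the ideal law in total variation gives `H(K, E^n) ≈ log |K| + ∑ i, H(E i)`. So the
average of the single-letter rates is at least the key rate up to `o(1)`, and some letter is at
least average.

*Achievability.* One message suffices. For each state sequence a random codebook of rate below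
`I(U;B|S)` is drawn, and each pair of state sequence and codeword index gets a random key. A
threshold decoder finds the index (`sum_thresholdError_le`). The key and the warden's output are
close to ideal by soft covering with the randomness of the index and of the state
(`sum_codebookLaw_dist_le`): distinct codewords are independent, so the variance is the sum of the
second moments of the single contributions, and it is small once the rate of the index exceeds
`R_K + I(U,S;E) - H(S)`. The two conditions leave room for every key rate below the single-letter
rate.
-/

noncomputable section

namespace CovertKey

/-! ### Independent coordinates -/

section ProductLaw

variable {ι Y : Type*} [Fintype ι] [DecidableEq ι] [Fintype Y]

/-- Under a product law, a function of the coordinate `i` is independent of a function that does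
not depend on that coordinate. -/
theorem sum_prod_mul_of_update {w : ι → Y → ℝ} (hw : ∀ i, ∑ v, w i v = 1) (i : ι)
    (ψ : Y → ℝ) {φ : (ι → Y) → ℝ} (hφ : ∀ y v, φ (Function.update y i v) = φ y) :
    ∑ y : ι → Y, (∏ j, w j (y j)) * (ψ (y i) * φ y)
      = (∑ v, w i v * ψ v) * ∑ y : ι → Y, (∏ j, w j (y j)) * φ y := by
  have key : ∀ χ : Y → ℝ, ∑ y : ι → Y, (∏ j, w j (y j)) * (χ (y i) * φ y)
      = (∑ v, w i v * χ v) * ∑ z : {j // j ≠ i} → Y, (∏ j : {j // j ≠ i}, w j (z j)) *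
          ∑ v, w i v * φ ((Equiv.funSplitAt i Y).symm (v, z)) := by
    intro χ
    rw [← (Equiv.funSplitAt i Y).symm.sum_comp, Fintype.sum_prod_type, Finset.sum_mul]
    refine Finset.sum_congr rfl fun v _ => ?_
    rw [Finset.mul_sum]
    refine Finset.sum_congr rfl fun z _ => ?_
    have h1 : ∀ u, φ ((Equiv.funSplitAt i Y).symm (u, z))
        = φ ((Equiv.funSplitAt i Y).symm (v, z)) := by
      intro u
      rw [← hφ ((Equiv.funSplitAt i Y).symm (v, z)) u]
      congr 1
      funext j
      by_cases hj : j = i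
      · subst hj; simp [Equiv.funSplitAt]
      · simp [Equiv.funSplitAt, hj]
    rw [Finset.sum_congr rfl fun u _ => by rw [h1 u], ← Finset.sum_mul, hw i,
      Fintype.prod_eq_mul_prod_subtype_ne _ i]
    have h2 : ∀ j : {j // j ≠ i}, (Equiv.funSplitAt i Y).symm (v, z) j = z j := by
      intro j; simp [Equiv.funSplitAt, j.2]
    have h3 : (Equiv.funSplitAt i Y).symm (v, z) i = v := by simp [Equiv.funSplitAt]
    rw [h3, Finset.prod_congr rfl fun j _ => by rw [h2 j]]
    ring
  have h1 := key fun _ => 1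
  simp only [one_mul, mul_one, hw i] at h1
  rw [key ψ, h1]

theorem sum_prod_eq_one {w : ι → Y → ℝ} (hw : ∀ i, ∑ v, w i v = 1) :
    ∑ y : ι → Y, ∏ j, w j (y j) = 1 := by
  rw [← Fintype.piFinset_univ, ← Finset.prod_univ_sum]
  simp [hw]

theorem sum_prod_mul_coord {w : ι → Y → ℝ} (hw : ∀ i, ∑ v, w i v = 1) (i : ι) (ψ : Y → ℝ) :
    ∑ y : ι → Y, (∏ j, w j (y j)) * ψ (y i) = ∑ v, w i v * ψ v := by
  have := sum_prod_mul_of_update hw i ψ (φ := fun _ => 1) (fun _ _ => rfl)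
  simpa [sum_prod_eq_one hw] using this

theorem sum_prod_mul_two_coord {w : ι → Y → ℝ} (hw : ∀ i, ∑ v, w i v = 1) {i j : ι} (hij : i ≠ j)
    (ψ χ : Y → ℝ) :
    ∑ y : ι → Y, (∏ l, w l (y l)) * (ψ (y i) * χ (y j))
      = (∑ v, w i v * ψ v) * ∑ v, w j v * χ v := by
  rw [sum_prod_mul_of_update hw i ψ (φ := fun y => χ (y j)), sum_prod_mul_coord hw]
  intro y v
  simp [Function.update_of_ne hij.symm]

/-- The variance of a sum of independent centred variables is the sum of their variances. -/
theorem sum_prod_mul_sum_sq {w : ι → Y → ℝ} (hw : ∀ i, ∑ v, w i v = 1) (f : ι → Y → ℝ)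
    (hf : ∀ i, ∑ v, w i v * f i v = 0) :
    ∑ y : ι → Y, (∏ l, w l (y l)) * (∑ i, f i (y i)) ^ 2 = ∑ i, ∑ v, w i v * f i v ^ 2 := by
  have h1 : ∀ y : ι → Y, (∏ l, w l (y l)) * (∑ i, f i (y i)) ^ 2
      = ∑ i, ∑ j, (∏ l, w l (y l)) * (f i (y i) * f j (y j)) := by
    intro y
    rw [sq, Finset.sum_mul_sum, Finset.mul_sum]
    simp_rw [Finset.mul_sum]
  simp_rw [h1]
  rw [Finset.sum_comm]
  refine Finset.sum_congr rfl fun i _ => ?_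
  rw [Finset.sum_comm, Finset.sum_eq_single i]
  · simp_rw [← sq]
    exact sum_prod_mul_coord hw i fun v => f i v ^ 2
  · intro j _ hj
    rw [sum_prod_mul_two_coord hw hj.symm (f i) (f j), hf, zero_mul]
  · simp

/-- Chebyshev's inequality for the empirical mean of `n` independent copies of `f`. -/
theorem sum_prod_deviation_le {w : Y → ℝ} (hw : w ∈ stdSimplex ℝ Y) (f : Y → ℝ) {δ : ℝ}
    (hδ : 0 < δ) {n : ℕ} (hn : n ≠ 0) :
    ∑ y : Fin n → Y, (∏ i, w (y i)) *
        (if (n : ℝ) * δ ≤ |∑ i, (f (y i) - ∑ v, w v * f v)| then 1 else 0)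
      ≤ (∑ v, w v * (f v - ∑ v, w v * f v) ^ 2) / δ ^ 2 / n := by
  set μ := ∑ v, w v * f v with hμ
  have hn0 : (0 : ℝ) < n := by positivity
  have h0 : ∑ v, w v * (f v - μ) = 0 := by
    simp_rw [mul_sub]
    rw [Finset.sum_sub_distrib, ← Finset.sum_mul, hw.2, one_mul, ← hμ, sub_self]
  have h1 := sum_prod_mul_sum_sq (ι := Fin n) (w := fun _ => w) (fun _ => hw.2)
    (fun _ v => f v - μ) (fun _ => h0)
  rw [Finset.sum_const, Finset.card_univ, Fintype.card_fin, nsmul_eq_mul] at h1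
  have h2 : (∑ v, w v * (f v - μ) ^ 2) / δ ^ 2 / n
      = (n * ∑ v, w v * (f v - μ) ^ 2) / (n * δ) ^ 2 := by
    field_simp
  rw [h2, ← h1, le_div_iff₀ (by positivity), Finset.sum_mul]
  refine Finset.sum_le_sum fun y _ => ?_
  rw [mul_assoc]
  refine mul_le_mul_of_nonneg_left ?_ (Finset.prod_nonneg fun i _ => hw.1 _)
  split_ifs with h
  · rw [one_mul, ← sq_abs (∑ i, (f (y i) - μ))]
    exact pow_le_pow_left₀ (by positivity) h 2
  · rw [zero_mul]; positivity

/-- A function on a finite probability space takes a value at most its expectation. -/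
theorem exists_le_of_sum_mul_le {Ω : Type*} [Fintype Ω] {w : Ω → ℝ} (hw : w ∈ stdSimplex ℝ Ω)
    {F : Ω → ℝ} {b : ℝ} (h : ∑ c, w c * F c ≤ b) : ∃ c, F c ≤ b := by
  by_contra! hF
  have h1 : ∑ c, w c * b ≤ ∑ c, w c * F c :=
    Finset.sum_le_sum fun c _ => mul_le_mul_of_nonneg_left (hF c).le (hw.1 c)
  obtain ⟨c, -, hc⟩ : ∃ c ∈ Finset.univ, 0 < w c := by
    by_contra! h'
    have := hw.2 ▸ Finset.sum_nonpos h'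
    linarith
  have h2 : ∑ c, w c * b < ∑ c, w c * F c :=
    Finset.sum_lt_sum (fun c _ => mul_le_mul_of_nonneg_left (hF c).le (hw.1 c))
      ⟨c, Finset.mem_univ _, mul_lt_mul_of_pos_left (hF c) hc⟩
  rw [← Finset.sum_mul, hw.2, one_mul] at h2
  linarith

/-- The expected absolute deviation is at most the standard deviation. -/
theorem sum_mul_abs_le_sqrt {Ω : Type*} [Fintype Ω] {w : Ω → ℝ} (hw : w ∈ stdSimplex ℝ Ω)
    (F : Ω → ℝ) : ∑ c, w c * |F c| ≤ Real.sqrt (∑ c, w c * F c ^ 2) := by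
  refine Real.le_sqrt_of_sq_le ?_
  have h := Finset.sum_mul_sq_le_sq_mul_sq Finset.univ (fun c => Real.sqrt (w c))
    (fun c => Real.sqrt (w c) * |F c|)
  have h1 : ∀ c, Real.sqrt (w c) * (Real.sqrt (w c) * |F c|) = w c * |F c| := fun c => by
    rw [← mul_assoc, Real.mul_self_sqrt (hw.1 c)]
  simp_rw [h1, mul_pow, Real.sq_sqrt (hw.1 _), sq_abs, hw.2, one_mul] at h
  exact h

end ProductLaw

/-! ### Entropy -/

section Entropy

variable {Ω α β : Type*} [Fintype Ω]

/-- The entropy, in bits, of a (not necessarily normalised) mass function. -/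
def massEntropy [Fintype α] (p : α → ℝ) : ℝ :=
  -∑ x, p x * Real.logb 2 (p x)

theorem law_nonneg {p : Ω → ℝ} (hp : ∀ ω, 0 ≤ p ω) (X : Ω → α) (x : α) : 0 ≤ law p X x := by
  classical
  refine Finset.sum_nonneg fun ω _ => ?_
  split_ifs
  exacts [hp ω, le_rfl]

theorem le_law {p : Ω → ℝ} (hp : ∀ ω, 0 ≤ p ω) (X : Ω → α) (ω : Ω) : p ω ≤ law p X (X ω) := by
  classical
  unfold law
  refine le_trans (by simp) (Finset.single_le_sum (f := fun ω' => if X ω' = X ω then p ω' else 0)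
    (fun ω' _ => ?_) (Finset.mem_univ ω))
  split_ifs
  exacts [hp ω', le_rfl]

theorem sum_law_mul [Fintype α] (p : Ω → ℝ) (X : Ω → α) (g : α → ℝ) :
    ∑ x, law p X x * g x = ∑ ω, p ω * g (X ω) := by
  classical
  simp only [law, Finset.sum_mul, ite_mul, zero_mul]
  rw [Finset.sum_comm]
  simp

theorem sum_law [Fintype α] (p : Ω → ℝ) (X : Ω → α) : ∑ x, law p X x = ∑ ω, p ω := by
  simpa using sum_law_mul p X fun _ => 1

theorem law_mem_stdSimplex [Fintype α] {p : Ω → ℝ} (hp : p ∈ stdSimplex ℝ Ω) (X : Ω → α) :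
    law p X ∈ stdSimplex ℝ α :=
  ⟨law_nonneg hp.1 X, (sum_law p X).trans hp.2⟩

theorem law_comp [Fintype α] (p : Ω → ℝ) (X : Ω → α) (f : α → β) :
    law p (fun ω => f (X ω)) = law (law p X) f := by
  classical
  funext y
  have := sum_law_mul p X fun x => if f x = y then (1 : ℝ) else 0
  simp only [mul_ite, mul_one, mul_zero] at this
  unfold law at this ⊢
  exact this.symm

theorem law_congr {p : Ω → ℝ} {X : Ω → α} {Y : Ω → β} {x : α} {y : β}
    (h : ∀ ω, X ω = x ↔ Y ω = y) : law p X x = law p Y y := by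
  unfold law
  refine Finset.sum_congr rfl fun ω _ => ?_
  by_cases h0 : Y ω = y
  · rw [if_pos h0, if_pos ((h ω).2 h0)]
  · rw [if_neg h0, if_neg (mt (h ω).1 h0)]

theorem law_eq_sum_law_pair [Fintype α] (p : Ω → ℝ) (X : Ω → α) (Y : Ω → β) (y : β) :
    law p Y y = ∑ x, law p (fun ω => (X ω, Y ω)) (x, y) := by
  classical
  unfold law
  rw [Finset.sum_comm]
  refine Finset.sum_congr rfl fun ω _ => ?_
  by_cases h0 : Y ω = y <;> simp [h0]

theorem entropy_eq_massEntropy [Fintype α] (p : Ω → ℝ) (X : Ω → α) :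
    entropy p X = massEntropy (law p X) := rfl

theorem entropy_eq_sum [Fintype α] (p : Ω → ℝ) (X : Ω → α) :
    entropy p X = -∑ ω, p ω * Real.logb 2 (law p X (X ω)) := by
  rw [entropy, sum_law_mul p X fun x => Real.logb 2 (law p X x)]

/-- Random variables that determine one another have the same entropy. -/
theorem entropy_congr [Fintype α] [Fintype β] (p : Ω → ℝ) {X : Ω → α} {Y : Ω → β}
    (h : ∀ ω ω', X ω' = X ω ↔ Y ω' = Y ω) : entropy p X = entropy p Y := by
  rw [entropy_eq_sum, entropy_eq_sum]
  simp_rw [law_congr (h _)]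

/-- A random variable that is determined by `Y` has at most the entropy of `Y`. -/
theorem entropy_le_of_determined [Fintype α] [Fintype β] {p : Ω → ℝ} (hp : ∀ ω, 0 ≤ p ω)
    {X : Ω → α} {Y : Ω → β} (h : ∀ ω ω', Y ω' = Y ω → X ω' = X ω) :
    entropy p X ≤ entropy p Y := by
  rw [entropy_eq_sum, entropy_eq_sum, neg_le_neg_iff]
  refine Finset.sum_le_sum fun ω _ => ?_
  rcases (hp ω).eq_or_lt with h0 | h0
  · simp [← h0]
  refine mul_le_mul_of_nonneg_left ?_ (hp ω)
  refine Real.logb_le_logb_of_le (by norm_num) (h0.trans_le (le_law hp Y ω)) ?_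
  unfold law
  refine Finset.sum_le_sum fun ω' _ => ?_
  by_cases h1 : Y ω' = Y ω
  · simp [h1, h ω ω' h1]
  · simp only [h1, if_false]
    split_ifs
    exacts [hp ω', le_rfl]

/-- Gibbs' inequality: the cross entropy with a subprobability mass function is at least the
entropy. -/
theorem entropy_le_crossEntropy [Fintype α] {p : Ω → ℝ} (hp : p ∈ stdSimplex ℝ Ω) (X : Ω → α)
    {q : α → ℝ} (hq : ∀ x, 0 ≤ q x) (hq1 : ∑ x, q x ≤ 1) (hpos : ∀ ω, 0 < p ω → 0 < q (X ω)) :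
    entropy p X ≤ -∑ ω, p ω * Real.logb 2 (q (X ω)) := by
  rw [entropy_eq_sum, neg_le_neg_iff]
  have hl : 0 < Real.log 2 := Real.log_pos (by norm_num)
  have h1 : ∀ ω, p ω * Real.logb 2 (q (X ω)) ≤ p ω * Real.logb 2 (law p X (X ω))
      + (p ω * (q (X ω) / law p X (X ω)) - p ω) / Real.log 2 := by
    intro ω
    rcases (hp.1 ω).eq_or_lt with h0 | h0
    · simp [← h0]
    have hP := h0.trans_le (le_law hp.1 X ω)
    have hQ := hpos ω h0
    have h2 := Real.log_le_sub_one_of_pos (div_pos hQ hP)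
    rw [Real.log_div hQ.ne' hP.ne'] at h2
    simp only [Real.logb]
    rw [← mul_div_assoc, ← mul_div_assoc, ← add_div]
    refine div_le_div_of_nonneg_right ?_ hl.le
    nlinarith
  refine (Finset.sum_le_sum fun ω _ => h1 ω).trans ?_
  rw [Finset.sum_add_distrib, ← Finset.sum_div, Finset.sum_sub_distrib, hp.2,
    ← sum_law_mul p X fun x => q x / law p X x]
  have h3 : ∑ x, law p X x * (q x / law p X x) ≤ ∑ x, q x := by
    refine Finset.sum_le_sum fun x _ => ?_
    rcases (law_nonneg hp.1 X x).eq_or_lt with h0 | h0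
    · simpa [← h0] using hq x
    · rw [mul_div_cancel₀ _ h0.ne']
  have h4 : (∑ x, law p X x * (q x / law p X x) - 1) / Real.log 2 ≤ 0 :=
    div_nonpos_of_nonpos_of_nonneg (by linarith) hl.le
  linarith

/-- Subadditivity of entropy. -/
theorem entropy_pi_le_sum [Fintype α] {p : Ω → ℝ} (hp : p ∈ stdSimplex ℝ Ω) {n : ℕ}
    (X : Ω → Fin n → α) : entropy p X ≤ ∑ i, entropy p fun ω => X ω i := by
  classical
  refine (entropy_le_crossEntropy hp X
    (q := fun x => ∏ i, law p (fun ω => X ω i) (x i)) (fun x => Finset.prod_nonneg fun i _ =>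
      law_nonneg hp.1 _ _) (le_of_eq (sum_prod_eq_one
        (w := fun i => law p fun ω => X ω i) fun i => (law_mem_stdSimplex hp _).2))
    fun ω h0 => Finset.prod_pos fun i _ => h0.trans_le (le_law hp.1 (fun ω => X ω i) ω)).trans
      (le_of_eq ?_)
  simp_rw [entropy_eq_sum]
  rw [Finset.sum_neg_distrib, Finset.sum_comm, neg_inj]
  refine Finset.sum_congr rfl fun ω _ => ?_
  rcases (hp.1 ω).eq_or_lt with h0 | h0
  · simp [← h0]
  rw [← Finset.mul_sum, Real.logb, Real.log_prod, Finset.sum_div]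
  · simp only [Real.logb]
  · intro i _
    exact (h0.trans_le (le_law hp.1 (fun ω => X ω i) ω)).ne'

theorem neg_logb_mixture_le {κ t : ℝ} (hκ : 1 ≤ κ) (h0 : 0 ≤ t) (h1 : t ≤ 1) :
    -Real.logb 2 (t / 2 + 1 / (2 * κ)) ≤ 1 + (1 - t) * Real.logb 2 κ := by
  have hκ0 : 0 < κ := by linarith
  have h2 := Real.geom_mean_le_arith_mean2_weighted h0 (sub_nonneg.2 h1) zero_le_one
    (one_div_pos.2 hκ0).le (by ring)
  rw [Real.one_rpow, one_mul, mul_one] at h2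
  have h3 : (1 / 2) * (1 / κ) ^ (1 - t) ≤ t / 2 + 1 / (2 * κ) := by
    have : (1 - t) * (1 / κ) ≤ 1 / κ := by
      have := one_div_pos.2 hκ0
      nlinarith
    have h4 : 1 / (2 * κ) = (1 / 2) * (1 / κ) := by field_simp
    rw [h4]; linarith
  have h5 : 0 < (1 / κ) ^ (1 - t) := Real.rpow_pos_of_pos (one_div_pos.2 hκ0) _
  have h6 := Real.logb_le_logb_of_le (b := 2) (by norm_num) (by positivity) h3
  rw [Real.logb_mul (by norm_num) h5.ne', Real.logb_rpow_eq_mul_logb_of_pos (one_div_pos.2 hκ0),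
    one_div, one_div, Real.logb_inv, Real.logb_inv, Real.logb_self_eq_one (by norm_num)] at h6
  linarith

/-- Fano's inequality for a randomised estimate of `Z` from `X`: if `d x` is the law of the
estimate when `X = x`, then `∑ ω, p ω * (1 - d (X ω) (Z ω))` is the probability of an error. -/
theorem entropy_pair_le_fano [Fintype β] {κ : ℕ} (hκ : 1 ≤ κ) {p : Ω → ℝ}
    (hp : p ∈ stdSimplex ℝ Ω) (Z : Ω → Fin κ) (X : Ω → β) {d : β → Fin κ → ℝ}
    (hd : ∀ x, d x ∈ stdSimplex ℝ (Fin κ)) :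
    entropy p (fun ω => (Z ω, X ω)) ≤
      entropy p X + 1 + (∑ ω, p ω * (1 - d (X ω) (Z ω))) * Real.logb 2 κ := by
  have hκ1 : (1 : ℝ) ≤ κ := by exact_mod_cast hκ
  have hκ0 : (0 : ℝ) < κ := by linarith
  have hr : ∀ x k, 0 < d x k / 2 + 1 / (2 * κ) := fun x k => by
    have := (hd x).1 k
    positivity
  -- The cross entropy is taken with an even mixture of the estimate and a uniform guess.
  have h := entropy_le_crossEntropy hp (fun ω => (Z ω, X ω))
    (q := fun y => law p X y.2 * (d y.2 y.1 / 2 + 1 / (2 * κ)))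
    (fun y => mul_nonneg (law_nonneg hp.1 _ _) (hr _ _).le) ?_
    fun ω h0 => mul_pos (h0.trans_le (le_law hp.1 X ω)) (hr _ _)
  · refine h.trans ?_
    rw [entropy_eq_sum, Finset.sum_mul]
    have : ∑ ω, -(p ω * Real.logb 2 (law p X (X ω) * (d (X ω) (Z ω) / 2 + 1 / (2 * κ)))) ≤
        ∑ ω, (-(p ω * Real.logb 2 (law p X (X ω))) + p ω +
          p ω * (1 - d (X ω) (Z ω)) * Real.logb 2 κ) := by
      refine Finset.sum_le_sum fun ω _ => ?_
      rcases (hp.1 ω).eq_or_lt with h0 | h0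
      · simp [← h0]
      rw [Real.logb_mul (h0.trans_le (le_law hp.1 X ω)).ne' (hr _ _).ne']
      have := neg_logb_mixture_le hκ1 ((hd (X ω)).1 (Z ω))
        ((Finset.single_le_sum (fun k _ => (hd (X ω)).1 k) (Finset.mem_univ (Z ω))).trans
          (hd (X ω)).2.le)
      nlinarith
    rw [Finset.sum_add_distrib, Finset.sum_add_distrib, hp.2, Finset.sum_neg_distrib,
      Finset.sum_neg_distrib] at this
    exact this
  · rw [Fintype.sum_prod_type_right]
    have : ∀ x, ∑ k, law p X x * (d x k / 2 + 1 / (2 * κ)) = law p X x := by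
      intro x
      rw [← Finset.mul_sum, Finset.sum_add_distrib, ← Finset.sum_div, (hd x).2]
      simp only [Finset.sum_const, Finset.card_univ, Fintype.card_fin, nsmul_eq_mul]
      field_simp
      norm_num
    simp only [this]
    exact (law_mem_stdSimplex hp X).2.le

/-- Grouping: a mass function of total mass `D` on `N` points has entropy at most
`-D log (D / N)`. -/
theorem massEntropy_le [Fintype α] {d : α → ℝ} (hd : ∀ x, 0 ≤ d x) :
    massEntropy d ≤ -((∑ x, d x) * Real.logb 2 (∑ x, d x)) +
      (∑ x, d x) * Real.logb 2 (Fintype.card α) := by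
  set D := ∑ x, d x with hD
  have hl : 0 < Real.log 2 := Real.log_pos (by norm_num)
  rcases (Finset.sum_nonneg fun x (_ : x ∈ Finset.univ) => hd x).eq_or_lt with h0 | h0
  · have : ∀ x, d x = 0 := fun x =>
      (Finset.sum_eq_zero_iff_of_nonneg fun x _ => hd x).1 h0.symm x (Finset.mem_univ x)
    simp [massEntropy, hD, this]
  rw [← hD] at h0
  have hne : Nonempty α := by
    by_contra h
    rw [not_nonempty_iff] at h
    simp [hD] at h0
  have hN : (0 : ℝ) < Fintype.card α := by exact_mod_cast Fintype.card_pos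
  have h1 : ∀ x, -(d x * Real.logb 2 (d x)) ≤
      (D / Fintype.card α - d x) / Real.log 2 - d x * Real.logb 2 D
        + d x * Real.logb 2 (Fintype.card α) := by
    intro x
    rcases (hd x).eq_or_lt with hx | hx
    · simp only [← hx, zero_mul, neg_zero, sub_zero, add_zero]
      positivity
    have h2 := Real.log_le_sub_one_of_pos (div_pos (div_pos h0 hN) hx)
    rw [Real.log_div (div_pos h0 hN).ne' hx.ne', Real.log_div h0.ne' hN.ne'] at h2
    have h3 : d x * (Real.log D - Real.log (Fintype.card α) - Real.log (d x))
        ≤ D / Fintype.card α - d x := by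
      refine (mul_le_mul_of_nonneg_left h2 hx.le).trans (le_of_eq ?_)
      field_simp
    have h4 := div_le_div_of_nonneg_right h3 hl.le
    simp only [Real.logb]
    refine le_trans (le_of_eq ?_) (add_le_add_left (sub_le_sub_right h4 _) _)
    ring
  rw [massEntropy, ← Finset.sum_neg_distrib]
  refine (Finset.sum_le_sum fun x _ => h1 x).trans (le_of_eq ?_)
  rw [Finset.sum_add_distrib, Finset.sum_sub_distrib, ← Finset.sum_div, Finset.sum_sub_distrib,
    ← Finset.sum_mul, ← Finset.sum_mul, ← hD]
  simp only [Finset.sum_const, Finset.card_univ, nsmul_eq_mul]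
  field_simp
  ring

theorem neg_mul_log_le_add {x y : ℝ} (hx : 0 ≤ x) (hx1 : x ≤ 1) (hy : 0 ≤ y) (hy1 : y ≤ 1) :
    -(y * Real.log y) ≤ -(x * Real.log x) + -(|x - y| * Real.log |x - y|) + |x - y| := by
  rcases hx.eq_or_lt with rfl | hx0
  · simp [abs_of_nonneg hy]; exact hy
  rcases hy.eq_or_lt with rfl | hy0
  · have h1 := Real.log_nonpos hx hx1
    simp only [sub_zero, abs_of_nonneg hx]
    nlinarith
  rcases le_total x y with h | h
  · -- `t ↦ -t log t` is subadditive
    rw [abs_sub_comm, abs_of_nonneg (sub_nonneg.2 h)]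
    rcases h.eq_or_lt with rfl | h'
    · simp
    have h1 := Real.log_le_log hx0 h
    have h2 := Real.log_le_log (sub_pos.2 h') (by linarith : y - x ≤ y)
    nlinarith
  · rw [abs_of_nonneg (sub_nonneg.2 h)]
    have h1 : 0 ≤ -((x - y) * Real.log (x - y)) := by
      have := Real.log_nonpos (sub_nonneg.2 h) (by linarith)
      nlinarith
    have h2 : y * (Real.log x - Real.log y) ≤ x - y := by
      rw [← Real.log_div hx0.ne' hy0.ne']
      have := mul_le_mul_of_nonneg_left (Real.log_le_sub_one_of_pos (div_pos hx0 hy0)) hy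
      refine this.trans (le_of_eq ?_)
      field_simp
    have h3 := Real.log_nonpos hx hx1
    nlinarith

/-- Continuity of entropy in total variation. -/
theorem massEntropy_le_add_tvDist [Fintype α] {p q : α → ℝ} (hp : p ∈ stdSimplex ℝ α)
    (hq : q ∈ stdSimplex ℝ α) :
    massEntropy q ≤ massEntropy p - 2 * tvDist p q * Real.logb 2 (2 * tvDist p q)
      + 2 * tvDist p q * (Real.logb 2 (Fintype.card α) + 1 / Real.log 2) := by
  have hl : 0 < Real.log 2 := Real.log_pos (by norm_num)
  have hD : 2 * tvDist p q = ∑ x, |p x - q x| := by unfold tvDist; ring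
  have le1 : ∀ {r : α → ℝ}, r ∈ stdSimplex ℝ α → ∀ x, r x ≤ 1 := fun {r} hr x =>
    (Finset.single_le_sum (fun k _ => hr.1 k) (Finset.mem_univ x)).trans hr.2.le
  rw [hD]
  have h1 := massEntropy_le (d := fun x => |p x - q x|) fun x => abs_nonneg _
  have h2 : massEntropy q ≤ massEntropy p + massEntropy (fun x => |p x - q x|)
      + (∑ x, |p x - q x|) * (1 / Real.log 2) := by
    simp only [massEntropy]
    rw [Finset.sum_mul, ← Finset.sum_neg_distrib, ← Finset.sum_neg_distrib,
      ← Finset.sum_neg_distrib, ← Finset.sum_add_distrib, ← Finset.sum_add_distrib]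
    refine Finset.sum_le_sum fun x _ => ?_
    have := neg_mul_log_le_add (hp.1 x) (le1 hp x) (hq.1 x) (le1 hq x)
    have := div_le_div_of_nonneg_right this hl.le
    simp only [Real.logb]
    refine le_trans (le_of_eq ?_) (this.trans (le_of_eq ?_)) <;> ring
  linarith

theorem massEntropy_ideal {E : Type*} [Fintype E] {κ : ℕ} (hκ : 1 ≤ κ) {Q : E → ℝ}
    (hQ : Q ∈ stdSimplex ℝ E) (n : ℕ) :
    massEntropy (fun x : Fin κ × (Fin n → E) => (1 / (κ : ℝ)) * ∏ i, Q (x.2 i))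
      = Real.logb 2 κ + n * massEntropy Q := by
  have hκ0 : (0 : ℝ) < κ := by exact_mod_cast hκ
  have h1 : ∀ e : Fin n → E, (1 / (κ : ℝ)) * (∏ i, Q (e i)) *
      Real.logb 2 ((1 / (κ : ℝ)) * ∏ i, Q (e i)) =
      (1 / (κ : ℝ)) * (-((∏ i, Q (e i)) * Real.logb 2 κ)
        + ∑ i, (∏ j, Q (e j)) * Real.logb 2 (Q (e i))) := by
    intro e
    by_cases h0 : ∏ i, Q (e i) = 0
    · simp [h0]
    rw [Real.logb_mul (one_div_pos.2 hκ0).ne' h0, one_div, Real.logb_inv]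
    have : Real.logb 2 (∏ i, Q (e i)) = ∑ i, Real.logb 2 (Q (e i)) := by
      simp only [Real.logb]
      rw [Real.log_prod, Finset.sum_div]
      exact fun i _ h => h0 (Finset.prod_eq_zero (Finset.mem_univ i) h)
    rw [this, ← Finset.mul_sum]
    ring
  unfold massEntropy
  rw [Fintype.sum_prod_type]
  simp only [h1]
  rw [Finset.sum_const, Finset.card_univ, Fintype.card_fin, nsmul_eq_mul, ← Finset.mul_sum,
    ← mul_assoc, mul_one_div_cancel hκ0.ne', one_mul, Finset.sum_add_distrib,
    Finset.sum_neg_distrib, ← Finset.sum_mul,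
    sum_prod_eq_one (w := fun _ : Fin n => Q) (fun _ => hQ.2), Finset.sum_comm]
  have h2 : ∀ i : Fin n, ∑ e : Fin n → E, (∏ j, Q (e j)) * Real.logb 2 (Q (e i))
      = ∑ v, Q v * Real.logb 2 (Q v) := fun i =>
    sum_prod_mul_coord (w := fun _ : Fin n => Q) (fun _ => hQ.2) i fun v => Real.logb 2 (Q v)
  simp only [h2, Finset.sum_const, Finset.card_univ, Fintype.card_fin, nsmul_eq_mul]
  ring

end Entropy

/-! ### Convex hulls of compact sets -/

/-- In finite dimension the convex hull of a compact set is compact: by Carathéodory's theorem it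
is the image of the compact set of convex combinations of a fixed number of points. -/
theorem isCompact_convexHull {V : Type*} [AddCommGroup V] [Module ℝ V] [TopologicalSpace V]
    [IsTopologicalAddGroup V] [ContinuousSMul ℝ V] [FiniteDimensional ℝ V] {s : Set V}
    (hs : IsCompact s) : IsCompact (convexHull ℝ s) := by
  classical
  rcases s.eq_empty_or_nonempty with rfl | ⟨x₀, hx₀⟩
  · simp
  set d := Module.finrank ℝ V + 1
  have hK : IsCompact (stdSimplex ℝ (Fin d) ×ˢ Set.pi Set.univ fun _ : Fin d => s) :=
    (isCompact_stdSimplex ℝ _).prod (isCompact_univ_pi fun _ => hs)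
  have hcont : Continuous fun y : (Fin d → ℝ) × (Fin d → V) => ∑ i, y.1 i • y.2 i := by
    fun_prop
  convert hK.image hcont
  ext x
  constructor
  · intro hx
    obtain ⟨ι, _, z, w, hz, hind, hw, hw1, rfl⟩ := eq_pos_convex_span_of_mem_convexHull hx
    have hcard : Fintype.card ι ≤ Fintype.card (Fin d) := by
      simpa [d] using hind.card_le_finrank_succ.trans
        (Nat.succ_le_succ (Submodule.finrank_le _))
    obtain ⟨f⟩ := Function.Embedding.nonempty_of_card_le hcard
    refine ⟨(Function.extend f w 0, Function.extend f z fun _ => x₀), ⟨⟨fun i => ?_, ?_⟩, ?_⟩, ?_⟩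
    · by_cases h : ∃ a, f a = i
      · obtain ⟨a, rfl⟩ := h
        simpa [f.injective.extend_apply] using (hw a).le
      · simp [Function.extend_apply' _ _ _ h]
    · rw [← hw1]
      symm
      refine Finset.sum_of_injOn f f.injective.injOn (by simp) (fun i _ hi => ?_) fun a _ => ?_
      · exact Function.extend_apply' _ _ _ fun ⟨a, ha⟩ => hi ⟨a, by simp, ha⟩
      · simp [f.injective.extend_apply]
    · intro i _
      by_cases h : ∃ a, f a = i
      · obtain ⟨a, rfl⟩ := h
        simpa [f.injective.extend_apply] using hz ⟨a, rfl⟩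
      · simpa [Function.extend_apply' _ _ _ h] using hx₀
    · symm
      refine Finset.sum_of_injOn f f.injective.injOn (by simp) (fun i _ hi => ?_) fun a _ => ?_
      · dsimp only
        rw [Function.extend_apply' w _ _ fun ⟨a, ha⟩ => hi ⟨a, by simp, ha⟩]
        simp
      · simp [f.injective.extend_apply]
  · rintro ⟨⟨w, z⟩, ⟨hw, hz⟩, rfl⟩
    exact mem_convexHull_of_exists_fintype w z hw.1 hw.2 (fun i => hz i (Set.mem_univ i)) rfl

/-! ### The single-letter region -/

section MassEntropy

variable {α : Type*} [Fintype α]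

theorem massEntropy_smul {c : ℝ} (hc : c ≠ 0) (p : α → ℝ) :
    massEntropy (c • p) = c * massEntropy p - (c * Real.logb 2 c) * ∑ x, p x := by
  unfold massEntropy
  rw [mul_neg, Finset.mul_sum, Finset.mul_sum, ← neg_add', neg_inj, ← Finset.sum_add_distrib]
  refine Finset.sum_congr rfl fun x _ => ?_
  by_cases hx : p x = 0
  · simp [hx]
  · simp only [Pi.smul_apply, smul_eq_mul]
    rw [Real.logb_mul hc hx]
    ring

theorem continuous_massEntropy : Continuous (massEntropy : (α → ℝ) → ℝ) := by
  have h : ∀ p : α → ℝ, massEntropy p = -∑ x, p x * Real.log (p x) / Real.log 2 := fun p => by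
    simp [massEntropy, Real.logb, mul_div_assoc]
  rw [show (massEntropy : (α → ℝ) → ℝ) = fun p => -∑ x, p x * Real.log (p x) / Real.log 2 from
    funext h]
  refine Continuous.neg (continuous_finsetSum _ fun x _ => ?_)
  exact (Real.continuous_mul_log.comp (continuous_apply x)).div_const _

end MassEntropy

namespace StateChannel

variable {S A B E : Type*} [Fintype S] [Fintype A] [Fintype B] [Fintype E]
  (C : StateChannel S A B E)

/-- The mass function of the pair of receiver output and state when the pair of state and input
has mass function `π`. -/
def bobMass (π : S × A → ℝ) (x : B × S) : ℝ :=
  ∑ a, ∑ e, π (x.2, a) * C.W a x.2 (x.1, e)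

/-- The mass function of the pair of warden output and state when the pair of state and input
has mass function `π`. -/
def wardenMass (π : S × A → ℝ) (x : E × S) : ℝ :=
  ∑ a, ∑ b, π (x.2, a) * C.W a x.2 (b, x.1)

/-- The mass function of the warden output when the pair of state and input has mass function
`π`. -/
def wardenOut (π : S × A → ℝ) (e : E) : ℝ :=
  ∑ s, C.wardenMass π (e, s)

/-- The difference `H(E,S) - H(B,S)` when the pair of state and input has mass function `π`. It is
positively homogeneous. -/
def equivocationGap (π : S × A → ℝ) : ℝ :=
  massEntropy (C.wardenMass π) - massEntropy (C.bobMass π)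

/-- The difference `H(B,S) - H(E)` when the pair of state and input has mass function `π`. -/
def outputGap (π : S × A → ℝ) : ℝ :=
  massEntropy (C.bobMass π) - massEntropy (C.wardenOut π)

theorem continuous_bobMass : Continuous C.bobMass := by
  unfold bobMass; fun_prop

theorem continuous_wardenMass : Continuous C.wardenMass := by
  unfold wardenMass; fun_prop

theorem continuous_wardenOut : Continuous C.wardenOut := by
  unfold wardenOut wardenMass; fun_prop

theorem continuous_equivocationGap : Continuous C.equivocationGap :=
  (continuous_massEntropy.comp C.continuous_wardenMass).sub
    (continuous_massEntropy.comp C.continuous_bobMass)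

theorem continuous_outputGap : Continuous C.outputGap :=
  (continuous_massEntropy.comp C.continuous_bobMass).sub
    (continuous_massEntropy.comp C.continuous_wardenOut)

theorem sum_W (a : A) (s : S) : ∑ b, ∑ e, C.W a s (b, e) = 1 := by
  rw [← Fintype.sum_prod_type]; exact (C.W_mem a s).2

theorem sum_W' (a : A) (s : S) : ∑ e, ∑ b, C.W a s (b, e) = 1 := by
  rw [Finset.sum_comm]; exact C.sum_W a s

theorem sum_bobMass (π : S × A → ℝ) : ∑ x, C.bobMass π x = ∑ y, π y := by
  rw [Fintype.sum_prod_type_right, Fintype.sum_prod_type]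
  refine Finset.sum_congr rfl fun s _ => ?_
  simp only [bobMass]
  rw [Finset.sum_comm]
  simp_rw [← Finset.mul_sum, C.sum_W, mul_one]

theorem sum_wardenMass (π : S × A → ℝ) : ∑ x, C.wardenMass π x = ∑ y, π y := by
  rw [Fintype.sum_prod_type_right, Fintype.sum_prod_type]
  refine Finset.sum_congr rfl fun s _ => ?_
  simp only [wardenMass]
  rw [Finset.sum_comm]
  simp_rw [← Finset.mul_sum, C.sum_W', mul_one]

theorem bobMass_smul (c : ℝ) (π : S × A → ℝ) : C.bobMass (c • π) = c • C.bobMass π := by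
  funext x; simp [bobMass, Finset.mul_sum, mul_assoc]

theorem wardenMass_smul (c : ℝ) (π : S × A → ℝ) : C.wardenMass (c • π) = c • C.wardenMass π := by
  funext x; simp [wardenMass, Finset.mul_sum, mul_assoc]

theorem equivocationGap_zero : C.equivocationGap 0 = 0 := by
  have h1 : C.wardenMass 0 = 0 := by funext x; simp [wardenMass]
  have h2 : C.bobMass 0 = 0 := by funext x; simp [bobMass]
  simp [equivocationGap, h1, h2, massEntropy]

theorem equivocationGap_smul (c : ℝ) (π : S × A → ℝ) :
    C.equivocationGap (c • π) = c * C.equivocationGap π := by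
  by_cases hc : c = 0
  · simp [hc, equivocationGap_zero]
  unfold equivocationGap
  rw [wardenMass_smul, bobMass_smul, massEntropy_smul hc, massEntropy_smul hc, sum_bobMass,
    sum_wardenMass]
  ring

/-- The convex hull of the graph of `equivocationGap` over the joint laws of state and input. Its
points are the pairs of the joint law of `(S, A)` and the value `H(E,S|U) - H(B,S|U)` that the
auxiliary random variables on finite alphabets produce. -/
def gapHull : Set ((S × A → ℝ) × ℝ) :=
  convexHull ℝ ((fun π => (π, C.equivocationGap π)) '' stdSimplex ℝ (S × A))

theorem isCompact_gapHull : IsCompact C.gapHull :=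
  isCompact_convexHull ((isCompact_stdSimplex ℝ _).image
    (continuous_id.prodMk C.continuous_equivocationGap))

theorem mem_gapHull {U : Type*} [Fintype U] {π : U → S × A → ℝ} (h0 : ∀ u x, 0 ≤ π u x)
    (h1 : ∑ u, π u ∈ stdSimplex ℝ (S × A)) :
    (∑ u, π u, ∑ u, C.equivocationGap (π u)) ∈ C.gapHull := by
  classical
  -- The components are normalised; those of mass zero are replaced by an arbitrary law.
  let z : U → S × A → ℝ := fun u =>
    if ∑ x, π u x = 0 then ∑ u, π u else (∑ x, π u x)⁻¹ • π u
  have hz : ∀ u, z u ∈ stdSimplex ℝ (S × A) := by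
    intro u
    by_cases h : ∑ x, π u x = 0
    · simpa [z, h] using h1
    · simp only [z, if_neg h]
      refine ⟨fun x => ?_, ?_⟩
      · exact mul_nonneg (inv_nonneg.2 (Finset.sum_nonneg fun x _ => h0 u x)) (h0 u x)
      · simp only [Pi.smul_apply, smul_eq_mul]
        rw [← Finset.mul_sum, inv_mul_cancel₀ h]
  have hwz : ∀ u, (∑ x, π u x) • z u = π u := by
    intro u
    by_cases h : ∑ x, π u x = 0
    · rw [h, zero_smul]
      funext x
      exact ((Finset.sum_eq_zero_iff_of_nonneg fun x _ => h0 u x).1 h x (Finset.mem_univ x)).symm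
    · simp only [z, if_neg h]
      rw [smul_smul, mul_inv_cancel₀ h, one_smul]
  refine mem_convexHull_of_exists_fintype (fun u => ∑ x, π u x)
    (fun u => (z u, C.equivocationGap (z u))) (fun u => Finset.sum_nonneg fun x _ => h0 u x) ?_
    (fun u => ⟨z u, hz u, rfl⟩) ?_
  · rw [Finset.sum_comm, ← h1.2]
    exact Finset.sum_congr rfl fun x _ => (Finset.sum_apply x _ _).symm
  · have : ∀ u, (∑ x, π u x) • (z u, C.equivocationGap (z u))
        = (π u, C.equivocationGap (π u)) := by
      intro u
      rw [Prod.smul_mk, smul_eq_mul, ← equivocationGap_smul, hwz]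
    simp only [this]
    exact Prod.ext (by simp [Prod.fst_sum]) (by simp [Prod.snd_sum])

theorem exists_of_mem_gapHull {z : (S × A → ℝ) × ℝ} (hz : z ∈ C.gapHull) :
    ∃ (N : ℕ) (w : Fin N → ℝ) (π : Fin N → S × A → ℝ),
      w ∈ stdSimplex ℝ (Fin N) ∧ (∀ u x, 0 ≤ π u x) ∧ ∑ u, π u = z.1 ∧
        ∑ u, C.equivocationGap (π u) = z.2 := by
  obtain ⟨ι, _, w, y, hw0, hw1, hy, rfl⟩ := mem_convexHull_iff_exists_fintype.1 hz
  choose σ hσ hσy using hy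
  have e := Fintype.equivFin ι
  refine ⟨Fintype.card ι, fun u => w (e.symm u), fun u => w (e.symm u) • σ (e.symm u),
    ⟨fun u => hw0 _, by rw [e.symm.sum_comp, hw1]⟩,
    fun u x => mul_nonneg (hw0 _) ((hσ _).1 x), ?_, ?_⟩
  · rw [e.symm.sum_comp fun i => w i • σ i, Prod.fst_sum]
    exact Finset.sum_congr rfl fun i _ => by rw [← hσy i]; rfl
  · rw [e.symm.sum_comp fun i => C.equivocationGap (w i • σ i), Prod.snd_sum]
    exact Finset.sum_congr rfl fun i _ => by rw [← hσy i, equivocationGap_smul]; rfl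

section Law

variable {Ω U : Type*} [Fintype Ω]
  {p : Ω → ℝ} {V : Ω → U} {X : Ω → S} {Y : Ω → B} {Z : Ω → E} {π : U → S × A → ℝ}

theorem law_aux_warden_state
    (h : ∀ u s b e, law p (fun ω => (V ω, X ω, Y ω, Z ω)) (u, s, b, e)
      = ∑ a, π u (s, a) * C.W a s (b, e)) (u : U) (x : E × S) :
    law p (fun ω => (V ω, Z ω, X ω)) (u, x) = C.wardenMass (π u) x := by
  rw [law_eq_sum_law_pair p Y, wardenMass, Finset.sum_comm]
  refine Finset.sum_congr rfl fun b _ => (law_congr fun ω => ?_).trans (h u x.2 b x.1)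
  simp only [Prod.ext_iff]
  tauto

theorem law_aux_bob_state
    (h : ∀ u s b e, law p (fun ω => (V ω, X ω, Y ω, Z ω)) (u, s, b, e)
      = ∑ a, π u (s, a) * C.W a s (b, e)) (u : U) (x : B × S) :
    law p (fun ω => (V ω, Y ω, X ω)) (u, x) = C.bobMass (π u) x := by
  rw [law_eq_sum_law_pair p Z, bobMass, Finset.sum_comm]
  refine Finset.sum_congr rfl fun e _ => (law_congr fun ω => ?_).trans (h u x.2 x.1 e)
  simp only [Prod.ext_iff]
  tauto

theorem bobMass_sum [Fintype U] (π : U → S × A → ℝ) (x : B × S) :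
    C.bobMass (∑ u, π u) x = ∑ u, C.bobMass (π u) x := by
  simp only [bobMass, Finset.sum_apply, Finset.sum_mul]
  simp_rw [Finset.sum_comm (s := (Finset.univ : Finset E))]
  rw [Finset.sum_comm]

theorem wardenMass_sum [Fintype U] (π : U → S × A → ℝ) (x : E × S) :
    C.wardenMass (∑ u, π u) x = ∑ u, C.wardenMass (π u) x := by
  simp only [wardenMass, Finset.sum_apply, Finset.sum_mul]
  simp_rw [Finset.sum_comm (s := (Finset.univ : Finset B))]
  rw [Finset.sum_comm]

theorem law_bob_state [Fintype U]
    (h : ∀ u s b e, law p (fun ω => (V ω, X ω, Y ω, Z ω)) (u, s, b, e)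
      = ∑ a, π u (s, a) * C.W a s (b, e)) :
    law p (fun ω => (Y ω, X ω)) = C.bobMass (∑ u, π u) := by
  funext x
  rw [law_eq_sum_law_pair p V, bobMass_sum]
  exact Finset.sum_congr rfl fun u _ => C.law_aux_bob_state h u x

theorem law_warden [Fintype U]
    (h : ∀ u s b e, law p (fun ω => (V ω, X ω, Y ω, Z ω)) (u, s, b, e)
      = ∑ a, π u (s, a) * C.W a s (b, e)) :
    law p Z = C.wardenOut (∑ u, π u) := by
  funext e
  rw [law_eq_sum_law_pair p X, wardenOut]
  refine Finset.sum_congr rfl fun s _ => ?_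
  rw [law_eq_sum_law_pair p V, wardenMass_sum]
  refine Finset.sum_congr rfl fun u _ => (law_congr fun ω => ?_).trans
    (C.law_aux_warden_state h u (e, s))
  simp only [Prod.ext_iff]
  tauto

/-- The single-letter rate `H(U,S,E) - H(U,B,S) + H(B,S) - H(E)` in terms of the unnormalised
conditional laws `π u` of state and input. -/
theorem entropy_gap_eq [Fintype U]
    (h : ∀ u s b e, law p (fun ω => (V ω, X ω, Y ω, Z ω)) (u, s, b, e)
      = ∑ a, π u (s, a) * C.W a s (b, e)) :
    entropy p (fun ω => (V ω, Z ω, X ω)) - entropy p (fun ω => (V ω, Y ω, X ω))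
      + entropy p (fun ω => (Y ω, X ω)) - entropy p Z
      = C.outputGap (∑ u, π u) + ∑ u, C.equivocationGap (π u) := by
  have h1 : entropy p (fun ω => (V ω, Z ω, X ω)) = ∑ u, massEntropy (C.wardenMass (π u)) := by
    rw [entropy, Fintype.sum_prod_type, ← Finset.sum_neg_distrib]
    simp only [C.law_aux_warden_state h, massEntropy]
  have h2 : entropy p (fun ω => (V ω, Y ω, X ω)) = ∑ u, massEntropy (C.bobMass (π u)) := by
    rw [entropy, Fintype.sum_prod_type, ← Finset.sum_neg_distrib]
    simp only [C.law_aux_bob_state h, massEntropy]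
  rw [h1, h2, entropy_eq_massEntropy, entropy_eq_massEntropy, C.law_bob_state h, C.law_warden h,
    outputGap]
  simp only [equivocationGap]
  rw [Finset.sum_sub_distrib]
  ring

end Law

section Region

variable {U : Type*} [Fintype U]

theorem keyRate_eq_entropies (P : S × U × A × B × E → ℝ) :
    keyRate P = entropy P (fun ω => (ω.2.1, ω.2.2.2.2, ω.1))
      - entropy P (fun ω => (ω.2.1, ω.2.2.2.1, ω.1))
      + entropy P (fun ω => (ω.2.2.2.1, ω.1)) - entropy P (fun ω => ω.2.2.2.2) := by
  have h : entropy P (fun ω => (ω.1, ω.2.2.2.2)) = entropy P (fun ω => (ω.2.2.2.2, ω.1)) :=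
    entropy_congr P fun ω ω' => by simp only [Prod.ext_iff]; tauto
  unfold keyRate condMutualInfo condEntropy
  rw [h]
  ring

theorem law_auxiliary {P : S × U × A × B × E → ℝ} {π : U → S × A → ℝ}
    (hP : ∀ s u a b e, P (s, u, a, b, e) = π u (s, a) * C.W a s (b, e)) (u : U) (s : S) (b : B)
    (e : E) :
    law P (fun ω => (ω.2.1, ω.1, ω.2.2.2.1, ω.2.2.2.2)) (u, s, b, e)
      = ∑ a, π u (s, a) * C.W a s (b, e) := by
  classical
  simp only [law, Fintype.sum_prod_type, Prod.mk.injEq, hP, ite_and, Finset.sum_ite_irrel,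
    Finset.sum_const_zero, Finset.sum_ite_eq', Finset.mem_univ, if_true]

theorem sum_QS_mul {PU : S → U → ℝ} {PA : U → S → A → ℝ} (hPU : ∀ s, PU s ∈ stdSimplex ℝ U)
    (hPA : ∀ u s, PA u s ∈ stdSimplex ℝ A) (s : S) :
    ∑ a, (∑ u, fun x : S × A => C.QS x.1 * PU x.1 u * PA u x.1 x.2) (s, a) = C.QS s := by
  simp only [Finset.sum_apply]
  rw [Finset.sum_comm]
  simp_rw [← Finset.mul_sum, (hPA _ _).2, mul_one, ← Finset.mul_sum, (hPU _).2, mul_one]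

/-- The joint laws of state and input with the right state law, together with a value of the
auxiliary gap. -/
def stateGapHull : Set ((S × A → ℝ) × ℝ) :=
  C.gapHull ∩ {z | ∀ s, ∑ a, z.1 (s, a) = C.QS s}

theorem isCompact_stateGapHull : IsCompact C.stateGapHull := by
  refine C.isCompact_gapHull.inter_right ?_
  simp only [Set.ofPred_forall]
  exact isClosed_iInter fun s => isClosed_eq (by fun_prop) continuous_const

theorem mem_stateGapHull {π : U → S × A → ℝ} (h0 : ∀ u x, 0 ≤ π u x)
    (h1 : ∀ s, ∑ a, (∑ u, π u) (s, a) = C.QS s) :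
    (∑ u, π u, ∑ u, C.equivocationGap (π u)) ∈ C.stateGapHull := by
  refine ⟨C.mem_gapHull h0 ⟨fun x => ?_, ?_⟩, h1⟩
  · rw [Finset.sum_apply]; exact Finset.sum_nonneg fun u _ => h0 u x
  · rw [Fintype.sum_prod_type]
    simp only [h1, C.QS_mem.2]

/-- The single-letter rates are the values of a continuous function on a compact set. -/
theorem mem_keyRateValues_iff {x : ℝ} :
    x ∈ C.keyRateValues ↔ ∃ z ∈ C.stateGapHull, C.wardenOut z.1 = C.wardenInnocent ∧
      C.outputGap z.1 + z.2 = x := by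
  constructor
  · rintro ⟨N, P, ⟨⟨PU, PA, hPU, hPA, hP⟩, hE⟩, rfl⟩
    let π : Fin N → S × A → ℝ := fun u x => C.QS x.1 * PU x.1 u * PA u x.1 x.2
    have h := C.law_auxiliary (π := π) hP
    refine ⟨_, C.mem_stateGapHull (π := π) (fun u x => mul_nonneg (mul_nonneg (C.QS_mem.1 _)
      ((hPU _).1 _)) ((hPA _ _).1 _)) (C.sum_QS_mul hPU hPA), ?_, ?_⟩
    · rw [← hE]
      exact (C.law_warden h).symm
    · rw [keyRate_eq_entropies]
      exact (C.entropy_gap_eq h).symm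
  · rintro ⟨z, ⟨hz, hS⟩, hE, rfl⟩
    obtain ⟨N, w, π, hw, h0, h1, h2⟩ := C.exists_of_mem_gapHull hz
    classical
    -- The conditional laws are arbitrary where they condition on an event of mass zero.
    let PU : S → Fin N → ℝ := fun s => if C.QS s = 0 then w else
      fun u => (∑ a, π u (s, a)) / C.QS s
    let PA : Fin N → S → A → ℝ := fun u s => if ∑ a, π u (s, a) = 0 then C.innocent else
      fun a => π u (s, a) / ∑ a, π u (s, a)
    have hm : ∀ s, ∑ u, ∑ a, π u (s, a) = C.QS s := fun s => by
      rw [Finset.sum_comm, ← hS s, ← h1]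
      simp only [Finset.sum_apply]
    have hPU : ∀ s, PU s ∈ stdSimplex ℝ (Fin N) := by
      intro s
      by_cases h : C.QS s = 0
      · simpa [PU, h] using hw
      · simp only [PU, if_neg h]
        refine ⟨fun u => div_nonneg (Finset.sum_nonneg fun a _ => h0 _ _) (C.QS_mem.1 s), ?_⟩
        rw [← Finset.sum_div, hm, div_self h]
    have hPA : ∀ u s, PA u s ∈ stdSimplex ℝ A := by
      intro u s
      by_cases h : ∑ a, π u (s, a) = 0
      · simpa [PA, h] using C.innocent_mem
      · simp only [PA, if_neg h]
        refine ⟨fun a => div_nonneg (h0 _ _) (Finset.sum_nonneg fun a _ => h0 _ _), ?_⟩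
        rw [← Finset.sum_div, div_self h]
    have hprod : ∀ u s a, C.QS s * PU s u * PA u s a = π u (s, a) := by
      intro u s a
      have hu : C.QS s * PU s u = ∑ a, π u (s, a) := by
        by_cases h : C.QS s = 0
        · rw [h, zero_mul]
          have := (Finset.sum_eq_zero_iff_of_nonneg fun u _ => Finset.sum_nonneg fun a _ =>
            h0 u (s, a)).1 ((hm s).trans h) u (Finset.mem_univ u)
          exact this.symm
        · simp only [PU, if_neg h]
          rw [mul_div_cancel₀ _ h]
      rw [hu]
      by_cases h : ∑ a, π u (s, a) = 0
      · rw [h, zero_mul]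
        exact ((Finset.sum_eq_zero_iff_of_nonneg fun a _ => h0 u (s, a)).1 h a
          (Finset.mem_univ a)).symm
      · simp only [PA, if_neg h]
        rw [mul_div_cancel₀ _ h]
    let P : S × Fin N × A × B × E → ℝ := fun y =>
      C.QS y.1 * PU y.1 y.2.1 * PA y.2.1 y.1 y.2.2.1 * C.W y.2.2.1 y.1 (y.2.2.2.1, y.2.2.2.2)
    have h := C.law_auxiliary (U := Fin N) (π := π) (P := P)
      fun s u a b e => by simp only [P, hprod]
    refine ⟨N, P, ⟨⟨PU, PA, hPU, hPA, fun _ _ _ _ _ => rfl⟩, ?_⟩, ?_⟩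
    · rw [C.law_warden h, h1, hE]
    · rw [keyRate_eq_entropies, C.entropy_gap_eq h, h1, h2]

theorem bddAbove_keyRateValues : BddAbove C.keyRateValues := by
  have hc : Continuous fun z : (S × A → ℝ) × ℝ => C.outputGap z.1 + z.2 :=
    (C.continuous_outputGap.comp continuous_fst).add continuous_snd
  refine (C.isCompact_stateGapHull.bddAbove_image hc.continuousOn).mono ?_
  intro x hx
  obtain ⟨z, hz, -, rfl⟩ := C.mem_keyRateValues_iff.1 hx
  exact ⟨z, hz, rfl⟩

/-- A rate that is attained up to `ε` by laws that violate the constraint on the warden's output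
by at most `ε`, for every `ε`, is at most a rate attained under the exact constraint. -/
theorem le_sSup_keyRateValues_of_approx {R : ℝ}
    (h : ∀ ε > 0, ∃ z ∈ C.stateGapHull, (∀ e, |C.wardenOut z.1 e - C.wardenInnocent e| ≤ ε) ∧
      R - ε ≤ C.outputGap z.1 + z.2) : R ≤ sSup C.keyRateValues := by
  choose z hz hE hR using fun n : ℕ => h (1 / ((n : ℝ) + 1)) Nat.one_div_pos_of_nat
  obtain ⟨z₀, hz₀, φ, hφ, hlim⟩ := C.isCompact_stateGapHull.tendsto_subseq hz
  have hε : Tendsto (fun n : ℕ => 1 / ((φ n : ℝ) + 1)) atTop (𝓝 0) :=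
    (tendsto_one_div_add_atTop_nhds_zero_nat (𝕜 := ℝ)).comp hφ.tendsto_atTop
  have hfst : Tendsto (fun n => (z (φ n)).1) atTop (𝓝 z₀.1) :=
    (continuous_fst.tendsto z₀).comp hlim
  have hc : Continuous fun z : (S × A → ℝ) × ℝ => C.outputGap z.1 + z.2 :=
    (C.continuous_outputGap.comp continuous_fst).add continuous_snd
  have h1 : C.wardenOut z₀.1 = C.wardenInnocent := by
    funext e
    have h2 : Tendsto (fun n => |C.wardenOut (z (φ n)).1 e - C.wardenInnocent e|) atTop
        (𝓝 |C.wardenOut z₀.1 e - C.wardenInnocent e|) :=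
      ((((continuous_apply e).comp C.continuous_wardenOut).tendsto _).comp hfst
        |>.sub_const _).abs
    have h3 := le_of_tendsto_of_tendsto' h2 hε fun n => hE (φ n) e
    exact sub_eq_zero.1 (abs_eq_zero.1 (le_antisymm h3 (abs_nonneg _)))
  have h2 : R ≤ C.outputGap z₀.1 + z₀.2 := by
    have := le_of_tendsto_of_tendsto' (tendsto_const_nhds.sub hε) ((hc.tendsto z₀).comp hlim)
      fun n => hR (φ n)
    simpa using this
  exact h2.trans (le_csSup C.bddAbove_keyRateValues
    (C.mem_keyRateValues_iff.2 ⟨z₀, hz₀, h1, rfl⟩))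

end Region

end StateChannel

/-! ### The law induced by a code -/

section Reindex

variable {n : ℕ} {B E : Type*} [Fintype B] [Fintype E]

theorem sum_sum_eq_sum_pair (F : (Fin n → B) → (Fin n → E) → ℝ) :
    ∑ b, ∑ e, F b e = ∑ y : Fin n → B × E, F (fun i => (y i).1) fun i => (y i).2 := by
  rw [← Fintype.sum_prod_type', ← (Equiv.arrowProdEquivProdArrow (Fin n) (fun _ => B)
    fun _ => E).sum_comp]
  rfl

end Reindex

theorem abs_law_sub_le {Ω α : Type*} [Fintype Ω] (p q : Ω → ℝ) (X : Ω → α) (x : α) :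
    |law p X x - law q X x| ≤ 2 * tvDist p q := by
  classical
  unfold law tvDist
  rw [← Finset.sum_sub_distrib, ← mul_assoc, mul_one_div_cancel two_ne_zero, one_mul]
  refine (Finset.abs_sum_le_sum_abs _ _).trans (Finset.sum_le_sum fun ω _ => ?_)
  split_ifs
  · exact le_rfl
  · simp

namespace StateChannel

variable {S A B E : Type*} [Fintype S] [Fintype A] [Fintype B] [Fintype E]
  (C : StateChannel S A B E) {n M K : ℕ}

theorem sum_prod_W (a : Fin n → A) (s : Fin n → S) :
    ∑ b : Fin n → B, ∑ e : Fin n → E, ∏ i, C.W (a i) (s i) (b i, e i) = 1 := by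
  rw [sum_sum_eq_sum_pair fun b e => ∏ i, C.W (a i) (s i) (b i, e i)]
  exact sum_prod_eq_one (w := fun i y => C.W (a i) (s i) y) fun i => (C.W_mem _ _).2

/-- Given the inputs and the states, the outputs at time `i` are independent of the outputs at
the other times. -/
theorem sum_prod_W_mul (a : Fin n → A) (s : Fin n → S) (i : Fin n) (ψ : B × E → ℝ)
    {φ : (Fin n → B) → (Fin n → E) → ℝ}
    (hφ : ∀ b e v w, φ (Function.update b i v) (Function.update e i w) = φ b e) :
    ∑ b : Fin n → B, ∑ e : Fin n → E,
        (∏ j, C.W (a j) (s j) (b j, e j)) * (ψ (b i, e i) * φ b e)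
      = (∑ y, C.W (a i) (s i) y * ψ y) *
        ∑ b : Fin n → B, ∑ e : Fin n → E, (∏ j, C.W (a j) (s j) (b j, e j)) * φ b e := by
  rw [sum_sum_eq_sum_pair fun b e => (∏ j, C.W (a j) (s j) (b j, e j)) * (ψ (b i, e i) * φ b e),
    sum_sum_eq_sum_pair fun b e => (∏ j, C.W (a j) (s j) (b j, e j)) * φ b e]
  refine sum_prod_mul_of_update (w := fun j y => C.W (a j) (s j) y) (fun j => (C.W_mem _ _).2) i ψ
    (φ := fun y => φ (fun i => (y i).1) fun i => (y i).2) fun y v => ?_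
  rw [← hφ (fun i => (y i).1) (fun i => (y i).2) v.1 v.2]
  congr 1 <;>
  · funext j
    by_cases h : j = i
    · subst h; simp
    · simp [h]

/-- The sample space of a code: message, states, inputs, key, outputs of the receiver and outputs
of the warden. -/
abbrev CodeSpace (S A B E : Type*) (n M K : ℕ) : Type _ :=
  Fin M × (Fin n → S) × (Fin n → A) × Fin K × (Fin n → B) × (Fin n → E)

/-- The joint law that a code induces, as a mass function on its sample space. -/
def codePmf (c : Code S A B n M K) (ω : CodeSpace S A B E n M K) : ℝ :=
  C.codeLaw c ω.1 ω.2.1 ω.2.2.1 ω.2.2.2.1 ω.2.2.2.2.1 ω.2.2.2.2.2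

theorem codeLaw_nonneg (c : Code S A B n M K) (m : Fin M) (s : Fin n → S)
    (a : Fin n → A) (k : Fin K) (b : Fin n → B) (e : Fin n → E) :
    0 ≤ C.codeLaw c m s a k b e :=
  mul_nonneg (mul_nonneg (mul_nonneg (by positivity)
    (Finset.prod_nonneg fun i _ => C.QS_mem.1 _)) ((c.enc_mem _ _).1 _))
    (Finset.prod_nonneg fun i _ => (C.W_mem _ _).1 _)

theorem sum_outputs_codeLaw (c : Code S A B n M K) (m : Fin M) (s : Fin n → S)
    (a : Fin n → A) (k : Fin K) :
    ∑ b, ∑ e, C.codeLaw c m s a k b e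
      = (1 / (M : ℝ)) * (∏ i, C.QS (s i)) * c.enc m s (a, k) := by
  simp only [codeLaw]
  simp_rw [← Finset.mul_sum, C.sum_prod_W, mul_one]

theorem sum_states_codeLaw (hM : 1 ≤ M) (c : Code S A B n M K) (s : Fin n → S) :
    ∑ m, ∑ a, ∑ k, ∑ b, ∑ e, C.codeLaw c m s a k b e = ∏ i, C.QS (s i) := by
  have hM0 : (0 : ℝ) < M := by exact_mod_cast hM
  have h : ∀ m, ∑ a, ∑ k, c.enc m s (a, k) = 1 := fun m => by
    rw [← Fintype.sum_prod_type]; exact (c.enc_mem m s).2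
  simp_rw [C.sum_outputs_codeLaw, ← Finset.mul_sum, h]
  rw [Finset.sum_const, Finset.card_univ, Fintype.card_fin, nsmul_eq_mul]
  field_simp

theorem codePmf_mem (hM : 1 ≤ M) (c : Code S A B n M K) :
    C.codePmf c ∈ stdSimplex ℝ (CodeSpace S A B E n M K) := by
  refine ⟨fun ω => C.codeLaw_nonneg c _ _ _ _ _ _, ?_⟩
  simp only [Fintype.sum_prod_type, codePmf]
  rw [Finset.sum_comm]
  simp_rw [C.sum_states_codeLaw hM c]
  exact sum_prod_eq_one (w := fun _ => C.QS) fun _ => C.QS_mem.2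

theorem law_key_warden (c : Code S A B n M K) :
    law (C.codePmf c) (fun ω => (ω.2.2.2.1, ω.2.2.2.2.2)) = C.keyWardenLaw c := by
  classical
  funext x
  obtain ⟨k, e⟩ := x
  simp only [law, Fintype.sum_prod_type, Prod.mk.injEq, codePmf, keyWardenLaw, ite_and,
    Finset.sum_ite_irrel, Finset.sum_const_zero, Finset.sum_ite_eq', Finset.mem_univ, if_true]

theorem law_state (hM : 1 ≤ M) (c : Code S A B n M K) (i : Fin n) :
    law (C.codePmf c) (fun ω => ω.2.1 i) = C.QS := by
  classical
  funext s₀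
  have h : ∀ s : Fin n → S, ∑ m, ∑ a, ∑ k, ∑ b, ∑ e,
      (if s i = s₀ then C.codeLaw c m s a k b e else 0)
        = (∏ j, C.QS (s j)) * (if s i = s₀ then 1 else 0) := by
    intro s
    rw [← C.sum_states_codeLaw hM c s]
    by_cases h : s i = s₀ <;> simp [h]
  simp only [law, Fintype.sum_prod_type, codePmf]
  rw [Finset.sum_comm]
  simp_rw [h]
  rw [sum_prod_mul_coord (w := fun _ => C.QS) (fun _ => C.QS_mem.2) i
    fun s => if s = s₀ then 1 else 0]
  simp

/-- The outputs at time `i` depend on the input and the state at time `i` only: they are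
independent of any `V` that does not involve them. -/
theorem law_markov (c : Code S A B n M K) (i : Fin n) {U : Type*}
    {V : CodeSpace S A B E n M K → U}
    (hV : ∀ m s a k b e v w, V (m, s, a, k, Function.update b i v, Function.update e i w)
      = V (m, s, a, k, b, e)) (u : U) (s₀ : S) (b₀ : B) (e₀ : E) :
    law (C.codePmf c) (fun ω => (V ω, ω.2.1 i, ω.2.2.2.2.1 i, ω.2.2.2.2.2 i)) (u, s₀, b₀, e₀)
      = ∑ a₀, law (C.codePmf c) (fun ω => (V ω, ω.2.1 i, ω.2.2.1 i)) (u, s₀, a₀)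
        * C.W a₀ s₀ (b₀, e₀) := by
  classical
  rw [law_eq_sum_law_pair _ fun ω => ω.2.2.1 i]
  refine Finset.sum_congr rfl fun a₀ _ => ?_
  simp only [law, Fintype.sum_prod_type, codePmf, Finset.sum_mul, Prod.mk.injEq]
  refine Finset.sum_congr rfl fun m _ => Finset.sum_congr rfl fun s _ =>
    Finset.sum_congr rfl fun a _ => Finset.sum_congr rfl fun k _ => ?_
  by_cases h : s i = s₀ ∧ a i = a₀
  · obtain ⟨rfl, rfl⟩ := h
    have h1 := C.sum_prod_W_mul a s i (fun y => if y = (b₀, e₀) then 1 else 0)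
      (φ := fun b e => if V (m, s, a, k, b, e) = u then 1 else 0)
      fun b e v w => by simp only [hV]
    simp only [mul_ite, mul_one, mul_zero, Finset.sum_ite_eq', Finset.mem_univ, if_true] at h1
    have h2 := congrArg (((1 / (M : ℝ)) * (∏ i, C.QS (s i)) * c.enc m s (a, k)) * ·) h1
    simp only [Finset.mul_sum] at h2
    refine (Eq.trans ?_ h2).trans ?_
    · refine Finset.sum_congr rfl fun b _ => Finset.sum_congr rfl fun e _ => ?_
      by_cases h3 : V (m, s, a, k, b, e) = u <;> by_cases h4 : b i = b₀ <;>
        by_cases h5 : e i = e₀ <;> simp [codeLaw, h3, h4, h5]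
    · refine Finset.sum_congr rfl fun b _ => Finset.sum_congr rfl fun e _ => ?_
      by_cases h3 : V (m, s, a, k, b, e) = u
      · simp [codeLaw, h3]; ring
      · simp [h3]
  · refine Finset.sum_congr rfl fun b _ => Finset.sum_congr rfl fun e _ => ?_
    rw [if_neg (fun h' => h ⟨h'.2.2.1, h'.1⟩), if_neg (fun h' => h h'.2), zero_mul]

/-- The law of the key estimate for given outputs and states. -/
def keyDec (c : Code S A B n M K) (x : (Fin n → B) × (Fin n → S)) (k : Fin K) : ℝ :=
  ∑ m, c.dec x.1 x.2 (m, k)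

theorem keyDec_mem (c : Code S A B n M K) (x : (Fin n → B) × (Fin n → S)) :
    keyDec c x ∈ stdSimplex ℝ (Fin K) := by
  refine ⟨fun k => Finset.sum_nonneg fun m _ => (c.dec_mem _ _).1 _, ?_⟩
  rw [← (c.dec_mem x.1 x.2).2, Fintype.sum_prod_type_right]
  rfl

theorem errorProb_eq_sum (c : Code S A B n M K) :
    C.errorProb c = ∑ m, ∑ s, ∑ a, ∑ k, ∑ b, ∑ e,
      C.codeLaw c m s a k b e * (1 - c.dec b s (m, k)) := by
  unfold errorProb
  refine Finset.sum_congr rfl fun m _ => Finset.sum_congr rfl fun s _ =>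
    Finset.sum_congr rfl fun a _ => Finset.sum_congr rfl fun k _ =>
    Finset.sum_congr rfl fun b _ => Finset.sum_congr rfl fun e _ => ?_
  rw [← (c.dec_mem b s).2, mul_sub, Finset.mul_sum, ← Finset.sum_filter, Finset.filter_ne',
    ← Finset.sum_erase_eq_sub (Finset.mem_univ _)]

theorem sum_key_error_le (c : Code S A B n M K) :
    ∑ ω, C.codePmf c ω * (1 - keyDec c (ω.2.2.2.2.1, ω.2.1) ω.2.2.2.1) ≤ C.errorProb c := by
  rw [errorProb_eq_sum]
  simp only [Fintype.sum_prod_type, codePmf]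
  refine Finset.sum_le_sum fun m _ => Finset.sum_le_sum fun s _ => Finset.sum_le_sum fun a _ =>
    Finset.sum_le_sum fun k _ => Finset.sum_le_sum fun b _ => Finset.sum_le_sum fun e _ => ?_
  refine mul_le_mul_of_nonneg_left (sub_le_sub_left ?_ 1) (C.codeLaw_nonneg c _ _ _ _ _ _)
  exact Finset.single_le_sum (f := fun m => c.dec b s (m, k))
    (fun m _ => (c.dec_mem _ _).1 _) (Finset.mem_univ m)

theorem errorProb_nonneg (c : Code S A B n M K) : 0 ≤ C.errorProb c := by
  refine Finset.sum_nonneg fun m _ => Finset.sum_nonneg fun s _ => Finset.sum_nonneg fun a _ =>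
    Finset.sum_nonneg fun k _ => Finset.sum_nonneg fun b _ => Finset.sum_nonneg fun e _ =>
    Finset.sum_nonneg fun d _ => ?_
  split_ifs
  exacts [mul_nonneg (C.codeLaw_nonneg c _ _ _ _ _ _) ((c.dec_mem _ _).1 _), le_rfl]

theorem wardenInnocent_mem : C.wardenInnocent ∈ stdSimplex ℝ E := by
  refine ⟨fun e => Finset.sum_nonneg fun s _ => Finset.sum_nonneg fun a _ =>
    Finset.sum_nonneg fun b _ => mul_nonneg (mul_nonneg (C.QS_mem.1 _) (C.innocent_mem.1 _))
      ((C.W_mem _ _).1 _), ?_⟩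
  simp only [wardenInnocent]
  rw [Finset.sum_comm]
  have h : ∀ s, ∑ e, ∑ a, ∑ b, C.QS s * C.innocent a * C.W a s (b, e) = C.QS s := by
    intro s
    rw [Finset.sum_comm]
    simp_rw [← Finset.mul_sum, C.sum_W', mul_one, ← Finset.mul_sum, C.innocent_mem.2, mul_one]
  simp_rw [h, C.QS_mem.2]

theorem ideal_mem (hK : 1 ≤ K) :
    C.idealKeyWardenLaw n K ∈ stdSimplex ℝ (Fin K × (Fin n → E)) := by
  have hK0 : (0 : ℝ) < K := by exact_mod_cast hK
  refine ⟨fun x => mul_nonneg (by positivity)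
    (Finset.prod_nonneg fun i _ => C.wardenInnocent_mem.1 _), ?_⟩
  simp only [idealKeyWardenLaw, Fintype.sum_prod_type]
  simp_rw [← Finset.mul_sum]
  rw [sum_prod_eq_one (w := fun _ => C.wardenInnocent) fun _ => C.wardenInnocent_mem.2]
  simp [hK0.ne']

theorem law_ideal (hK : 1 ≤ K) (i : Fin n) :
    law (C.idealKeyWardenLaw n K) (fun x => x.2 i) = C.wardenInnocent := by
  classical
  have hK0 : (0 : ℝ) < K := by exact_mod_cast hK
  funext e₀
  have h := sum_prod_mul_coord (w := fun _ : Fin n => C.wardenInnocent)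
    (fun _ => C.wardenInnocent_mem.2) i fun e => if e = e₀ then 1 else 0
  simp only [mul_ite, mul_one, mul_zero, Finset.sum_ite_eq', Finset.mem_univ, if_true] at h
  simp only [law, idealKeyWardenLaw, Fintype.sum_prod_type]
  simp_rw [← mul_ite_zero, ← Finset.mul_sum, h]
  simp [hK0.ne']

/-! ### Converse -/

section Hybrid

variable {S A B E : Type*}

/-- The hybrid observation: the outputs of the receiver and the states before time `j`, the
outputs of the warden from time `j` on. -/
def hybrid (j : ℕ) (ω : CodeSpace S A B E n M K) (l : Fin n) : (B × S) ⊕ E :=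
  if (l : ℕ) < j then Sum.inl (ω.2.2.2.2.1 l, ω.2.1 l) else Sum.inr (ω.2.2.2.2.2 l)

/-- The auxiliary random variable at time `i`: the key, the outputs of the receiver and the states
before time `i`, and the outputs of the warden after time `i`. -/
def auxVar (i : Fin n) (ω : CodeSpace S A B E n M K) : Fin K × (Fin n → Option ((B × S) ⊕ E)) :=
  (ω.2.2.2.1, fun l => if l = i then none else some (hybrid i ω l))

theorem auxVar_warden_iff (i : Fin n) (ω ω' : CodeSpace S A B E n M K) :
    (auxVar i ω', ω'.2.2.2.2.2 i) = (auxVar i ω, ω.2.2.2.2.2 i) ↔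
      (ω'.2.2.2.1, hybrid i ω') = (ω.2.2.2.1, hybrid i ω) := by
  simp only [auxVar, Prod.mk.injEq, funext_iff]
  rw [and_assoc]
  refine and_congr_right fun _ => ⟨fun h l => ?_, fun h => ⟨fun l => ?_, ?_⟩⟩
  · by_cases hl : l = i
    · subst hl
      simp [hybrid, h.2]
    · simpa [hl] using h.1 l
  · simp [h l]
  · simpa [hybrid] using h i

theorem auxVar_bob_iff (i : Fin n) (ω ω' : CodeSpace S A B E n M K) :
    (auxVar i ω', ω'.2.2.2.2.1 i, ω'.2.1 i) = (auxVar i ω, ω.2.2.2.2.1 i, ω.2.1 i) ↔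
      (ω'.2.2.2.1, hybrid (i + 1) ω') = (ω.2.2.2.1, hybrid (i + 1) ω) := by
  have hne : ∀ (ω : CodeSpace S A B E n M K) l, l ≠ i → hybrid (i + 1) ω l = hybrid i ω l := by
    intro ω l hl
    have : (l : ℕ) < i + 1 ↔ (l : ℕ) < i := by
      have : (l : ℕ) ≠ i := fun h => hl (Fin.ext h)
      omega
    simp only [hybrid, this]
  have heq : ∀ ω : CodeSpace S A B E n M K,
      hybrid (i + 1) ω i = Sum.inl (ω.2.2.2.2.1 i, ω.2.1 i) := fun ω => by simp [hybrid]
  simp only [auxVar, Prod.mk.injEq, funext_iff]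
  rw [and_assoc]
  refine and_congr_right fun _ => ⟨fun h l => ?_, fun h => ⟨fun l => ?_, ?_⟩⟩
  · by_cases hl : l = i
    · subst hl
      rw [heq, heq, h.2.1, h.2.2]
    · have := h.1 l
      rw [hne _ _ hl, hne _ _ hl]
      simpa [hl] using this
  · by_cases hl : l = i
    · simp [hl]
    · have := h l
      rw [hne _ _ hl, hne _ _ hl] at this
      simp [hl, this]
  · have := h i
    rw [heq, heq] at this
    simpa using this

theorem auxVar_update (i : Fin n) (m : Fin M) (s : Fin n → S) (a : Fin n → A) (k : Fin K)
    (b : Fin n → B) (e : Fin n → E) (v : B) (w : E) :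
    auxVar i ((m, s, a, k, Function.update b i v, Function.update e i w) :
      CodeSpace S A B E n M K) = auxVar i (m, s, a, k, b, e) := by
  refine Prod.ext rfl (funext fun l => ?_)
  by_cases hl : l = i
  · simp [auxVar, hl]
  · simp [auxVar, hl, hybrid]

end Hybrid

/-- The single-letter rate at time `i` of the law that a code induces. -/
def letterRate (c : Code S A B n M K) (i : Fin n) : ℝ :=
  entropy (C.codePmf c) (fun ω => (auxVar i ω, ω.2.2.2.2.2 i, ω.2.1 i))
    - entropy (C.codePmf c) (fun ω => (auxVar i ω, ω.2.2.2.2.1 i, ω.2.1 i))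
    + entropy (C.codePmf c) (fun ω => (ω.2.2.2.2.1 i, ω.2.1 i))
    - entropy (C.codePmf c) (fun ω => ω.2.2.2.2.2 i)

/-- The hybrid observations at consecutive times differ in one letter, so the conditional
entropies of the auxiliary variables telescope. -/
theorem entropy_sub_le_sum_letterRate (hM : 1 ≤ M) (c : Code S A B n M K) :
    entropy (C.codePmf c) (fun ω => (ω.2.2.2.1, ω.2.2.2.2.2))
      - entropy (C.codePmf c) (fun ω => (ω.2.2.2.1, ω.2.2.2.2.1, ω.2.1))
      + entropy (C.codePmf c) (fun ω => (ω.2.2.2.2.1, ω.2.1))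
      - ∑ i, entropy (C.codePmf c) (fun ω => ω.2.2.2.2.2 i) ≤ ∑ i, C.letterRate c i := by
  set p := C.codePmf c with hp
  have hmem := C.codePmf_mem hM c
  rw [← hp] at hmem
  let f : ℕ → ℝ := fun j => entropy p fun ω => (ω.2.2.2.1, hybrid j ω)
  have h0 : entropy p (fun ω => (ω.2.2.2.1, ω.2.2.2.2.2)) = f 0 :=
    entropy_congr p fun ω ω' => by simp [hybrid, funext_iff]
  have hn : entropy p (fun ω => (ω.2.2.2.1, ω.2.2.2.2.1, ω.2.1)) = f n :=
    entropy_congr p fun ω ω' => by simp [hybrid, funext_iff, forall_and]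
  have hX : entropy p (fun ω => (ω.2.2.2.2.1, ω.2.1)) ≤
      ∑ i, entropy p fun ω => (ω.2.2.2.2.1 i, ω.2.1 i) := by
    refine le_trans (le_of_eq ?_) (entropy_pi_le_sum hmem fun ω i => (ω.2.2.2.2.1 i, ω.2.1 i))
    exact entropy_congr p fun ω ω' => by simp [funext_iff, forall_and]
  have htel : ∑ i : Fin n, (f i - f (i + 1)) = f 0 - f n := by
    rw [Fin.sum_univ_eq_sum_range (fun i => f i - f (i + 1)), Finset.sum_range_sub']
  have hle : ∀ i : Fin n, f i - f (i + 1) + entropy p (fun ω => (ω.2.2.2.2.1 i, ω.2.1 i))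
      - entropy p (fun ω => ω.2.2.2.2.2 i) ≤ C.letterRate c i := by
    intro i
    have h1 : f i ≤ entropy p (fun ω => (auxVar i ω, ω.2.2.2.2.2 i, ω.2.1 i)) := by
      change entropy p (fun ω => (ω.2.2.2.1, hybrid i ω)) ≤ _
      rw [← entropy_congr p (auxVar_warden_iff i)]
      refine entropy_le_of_determined hmem.1 fun ω ω' h => ?_
      simp only [Prod.mk.injEq] at h ⊢
      exact ⟨h.1, h.2.1⟩
    have h2 : f (i + 1) = entropy p (fun ω => (auxVar i ω, ω.2.2.2.2.1 i, ω.2.1 i)) :=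
      (entropy_congr p (auxVar_bob_iff i)).symm
    unfold letterRate
    linarith
  have hsum := Finset.sum_le_sum fun i (_ : i ∈ Finset.univ) => hle i
  rw [Finset.sum_sub_distrib, Finset.sum_add_distrib, htel] at hsum
  linarith

theorem exists_letterRate_eq (hM : 1 ≤ M) (c : Code S A B n M K) (i : Fin n) :
    ∃ z ∈ C.stateGapHull, C.wardenOut z.1 = law (C.codePmf c) (fun ω => ω.2.2.2.2.2 i) ∧
      C.outputGap z.1 + z.2 = C.letterRate c i := by
  let π : Fin K × (Fin n → Option ((B × S) ⊕ E)) → S × A → ℝ := fun u x =>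
    law (C.codePmf c) (fun ω => (auxVar i ω, ω.2.1 i, ω.2.2.1 i)) (u, x)
  have h := C.law_markov c i (V := auxVar i) (auxVar_update i)
  refine ⟨_, C.mem_stateGapHull (π := π) (fun u x => law_nonneg (C.codePmf_mem hM c).1 _ _) ?_,
    (C.law_warden (π := π) h).symm, (C.entropy_gap_eq (π := π) h).symm⟩
  intro s
  rw [← C.law_state hM c i, law_eq_sum_law_pair _ fun ω => ω.2.2.1 i]
  refine Finset.sum_congr rfl fun a _ => ?_
  rw [law_eq_sum_law_pair _ (auxVar i), Finset.sum_apply]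
  exact Finset.sum_congr rfl fun u _ => law_congr fun ω => by
    simp only [Prod.mk.injEq]; tauto

theorem abs_law_warden_sub_le (hK : 1 ≤ K) (c : Code S A B n M K) (i : Fin n) (e : E) :
    |law (C.codePmf c) (fun ω => ω.2.2.2.2.2 i) e - C.wardenInnocent e|
      ≤ 2 * tvDist (C.keyWardenLaw c) (C.idealKeyWardenLaw n K) := by
  have h : law (C.codePmf c) (fun ω => ω.2.2.2.2.2 i)
      = law (C.keyWardenLaw c) (fun x => x.2 i) := by
    rw [← law_key_warden]
    exact law_comp _ (fun ω : CodeSpace S A B E n M K => (ω.2.2.2.1, ω.2.2.2.2.2))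
      fun x : Fin K × (Fin n → E) => x.2 i
  rw [← C.law_ideal hK i, h]
  exact abs_law_sub_le _ _ _ _

theorem card_warden_pos (C : StateChannel S A B E) : 0 < Fintype.card E := by
  by_contra h
  have h1 := C.wardenInnocent_mem.2
  rw [not_lt, Nat.le_zero, Fintype.card_eq_zero_iff] at h
  simp at h1

/-- The converse bound for one code: Fano's inequality bounds the equivocation of the receiver and
continuity of entropy bounds the equivocation of the warden. -/
theorem key_le_sum_letterRate (hM : 1 ≤ M) (hK : 1 ≤ K) (c : Code S A B n M K) {η : ℝ}
    (hη : ∀ i, entropy (C.codePmf c) (fun ω => ω.2.2.2.2.2 i) ≤ massEntropy C.wardenInnocent + η) :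
    Real.logb 2 K * (1 - C.errorProb c -
        2 * tvDist (C.keyWardenLaw c) (C.idealKeyWardenLaw n K)) - 1
      + 2 * tvDist (C.keyWardenLaw c) (C.idealKeyWardenLaw n K) *
        Real.logb 2 (2 * tvDist (C.keyWardenLaw c) (C.idealKeyWardenLaw n K))
      - 2 * tvDist (C.keyWardenLaw c) (C.idealKeyWardenLaw n K) *
        (n * Real.logb 2 (Fintype.card E) + 1 / Real.log 2) - n * η
      ≤ ∑ i, C.letterRate c i := by
  have hmem := C.codePmf_mem hM c
  have hK1 : (1 : ℝ) ≤ K := by exact_mod_cast hK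
  have hE : (Fintype.card E : ℝ) ≠ 0 := by exact_mod_cast C.card_warden_pos.ne'
  have h1 := C.entropy_sub_le_sum_letterRate hM c
  have h2 := entropy_pair_le_fano hK hmem (fun ω => ω.2.2.2.1)
    (fun ω => (ω.2.2.2.2.1, ω.2.1)) (keyDec_mem c)
  have h3 := mul_le_mul_of_nonneg_right (C.sum_key_error_le c)
    (Real.logb_nonneg (b := 2) (by norm_num) hK1)
  have h4 := massEntropy_le_add_tvDist (p := C.keyWardenLaw c)
    (by rw [← law_key_warden]; exact law_mem_stdSimplex hmem _) (C.ideal_mem (n := n) hK)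
  have h5 : massEntropy (C.idealKeyWardenLaw n K)
      = Real.logb 2 K + n * massEntropy C.wardenInnocent :=
    massEntropy_ideal hK C.wardenInnocent_mem n
  have h6 : Real.logb 2 (Fintype.card (Fin K × (Fin n → E)))
      = Real.logb 2 K + n * Real.logb 2 (Fintype.card E) := by
    rw [Fintype.card_prod, Fintype.card_fin, Fintype.card_fun, Fintype.card_fin]
    push_cast
    rw [Real.logb_mul (by positivity) (pow_ne_zero _ hE), Real.logb_pow]
  have h7 : entropy (C.codePmf c) (fun ω => (ω.2.2.2.1, ω.2.2.2.2.2))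
      = massEntropy (C.keyWardenLaw c) := by
    rw [entropy_eq_massEntropy, law_key_warden]
  have h8 := Finset.sum_le_sum fun i (_ : i ∈ Finset.univ) => hη i
  rw [Finset.sum_const, Finset.card_univ, Fintype.card_fin, nsmul_eq_mul] at h8
  rw [h5, h6] at h4
  nlinarith

theorem one_le_floor_two_rpow {x : ℝ} (hx : 0 ≤ x) (n : ℕ) : 1 ≤ ⌊(2 : ℝ) ^ ((n : ℝ) * x)⌋₊ :=
  Nat.le_floor (by simpa using Real.one_le_rpow (by norm_num) (by positivity))

/-- The converse: some letter of a good code has a single-letter rate close to the key rate, and a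
warden output law close to the innocent one. -/
theorem le_sSup_of_achievable {R RK : ℝ} (h : C.Achievable R RK) : RK ≤ sSup C.keyRateValues := by
  obtain ⟨hR, hRK, c, herr, htv⟩ := h
  refine C.le_sSup_keyRateValues_of_approx fun ε hε => ?_
  set t : ℕ → ℝ := fun n => 2 * tvDist (C.keyWardenLaw (c n)) (C.idealKeyWardenLaw n _) with ht_def
  have ht : Tendsto t atTop (𝓝 0) := by simpa using htv.const_mul 2
  obtain ⟨δ, hδ, hcont⟩ := Metric.continuousAt_iff.1
    (continuous_massEntropy.continuousAt (x := C.wardenInnocent)) (ε / 4) (by positivity)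
  -- The total loss, divided by the block length.
  have hloss : Tendsto (fun n : ℕ => RK * (C.errorProb (c n) + t n) + 2 / (n : ℝ)
      - (t n * Real.logb 2 (t n)) * (1 / (n : ℝ))
      + t n * (Real.logb 2 (Fintype.card E) + (1 / Real.log 2) * (1 / (n : ℝ)))) atTop (𝓝 0) := by
    have h1 : Tendsto (fun n => t n * Real.logb 2 (t n)) atTop (𝓝 0) := by
      have := (Real.continuous_mul_log.tendsto 0).comp ht
      have := this.div_const (Real.log 2)
      simpa [Function.comp_def, Real.logb, mul_div_assoc] using this
    have h2 : Tendsto (fun n : ℕ => 1 / (n : ℝ)) atTop (𝓝 0) := tendsto_one_div_atTop_nhds_zero_nat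
    have h3 : Tendsto (fun n : ℕ => 2 / (n : ℝ)) atTop (𝓝 0) :=
      tendsto_const_div_atTop_nhds_zero_nat 2
    have := ((((herr.add ht).const_mul RK).add h3).sub (h1.mul h2)).add
      (ht.mul ((h2.const_mul (1 / Real.log 2)).const_add (Real.logb 2 (Fintype.card E))))
    simpa using this
  obtain ⟨n, hn1, hn2, hn3, hn4, hn5⟩ : ∃ n : ℕ, 1 ≤ n ∧ t n < δ ∧ t n ≤ ε ∧
      C.errorProb (c n) + t n < 1 ∧
      RK * (C.errorProb (c n) + t n) + 2 / (n : ℝ)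
      - (t n * Real.logb 2 (t n)) * (1 / (n : ℝ))
      + t n * (Real.logb 2 (Fintype.card E) + (1 / Real.log 2) * (1 / (n : ℝ))) < ε / 2 := by
    have h4 : Tendsto (fun n => C.errorProb (c n) + t n) atTop (𝓝 0) := by
      simpa using herr.add ht
    exact ((eventually_ge_atTop 1).and ((ht.eventually_lt_const hδ).and
      ((ht.eventually_le_const hε).and ((h4.eventually_lt_const one_pos).and
      (hloss.eventually_lt_const (by positivity)))))).exists
  have hn0 : (0 : ℝ) < n := by exact_mod_cast hn1
  have hM := one_le_floor_two_rpow hR n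
  have hK := one_le_floor_two_rpow hRK n
  have habs := fun i e => C.abs_law_warden_sub_le hK (c n) i e
  have hη : ∀ i, entropy (C.codePmf (c n)) (fun ω => ω.2.2.2.2.2 i)
      ≤ massEntropy C.wardenInnocent + ε / 4 := by
    intro i
    have hd : dist (law (C.codePmf (c n)) (fun ω => ω.2.2.2.2.2 i)) C.wardenInnocent < δ :=
      (dist_pi_lt_iff hδ).2 fun e => (habs i e).trans_lt hn2
    have := (abs_lt.1 (hcont hd)).2
    rw [entropy_eq_massEntropy]
    linarith
  have hmain := C.key_le_sum_letterRate hM hK (c n) hη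
  -- Rounding down the number of key values costs at most one bit.
  have hlog : n * RK - 1 ≤ Real.logb 2 (⌊(2 : ℝ) ^ ((n : ℝ) * RK)⌋₊ : ℝ) := by
    have h1 : (2 : ℝ) ^ ((n : ℝ) * RK - 1) ≤ (⌊(2 : ℝ) ^ ((n : ℝ) * RK)⌋₊ : ℝ) := by
      rw [Real.rpow_sub (by norm_num), Real.rpow_one]
      have h2 := Nat.lt_floor_add_one ((2 : ℝ) ^ ((n : ℝ) * RK))
      have h3 : (1 : ℝ) ≤ (⌊(2 : ℝ) ^ ((n : ℝ) * RK)⌋₊ : ℝ) := by exact_mod_cast hK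
      linarith
    have h2 := Real.logb_le_logb_of_le (b := 2) (by norm_num) (by positivity) h1
    rwa [Real.logb_rpow (by norm_num) (by norm_num)] at h2
  have herr0 := C.errorProb_nonneg (c n)
  have ht0 : 0 ≤ t n := by
    simp only [ht_def, tvDist]
    have := Finset.sum_nonneg fun x (_ : x ∈ Finset.univ) =>
      abs_nonneg (C.keyWardenLaw (c n) x - C.idealKeyWardenLaw n _ x)
    linarith
  have hsum : n * (RK - ε) ≤ ∑ i, C.letterRate (c n) i := by
    change Real.logb 2 _ * (1 - C.errorProb (c n) - t n) - 1 + t n * Real.logb 2 (t n)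
      - t n * (n * Real.logb 2 (Fintype.card E) + 1 / Real.log 2) - n * (ε / 4) ≤ _ at hmain
    have h1 := mul_le_mul_of_nonneg_right hlog
      (by linarith : 0 ≤ 1 - C.errorProb (c n) - t n)
    have h2 := mul_lt_mul_of_pos_left hn5 hn0
    have h3 : (n : ℝ) * (RK * (C.errorProb (c n) + t n) + 2 / (n : ℝ)
        - (t n * Real.logb 2 (t n)) * (1 / (n : ℝ))
        + t n * (Real.logb 2 (Fintype.card E) + (1 / Real.log 2) * (1 / (n : ℝ))))
        = n * (RK * (C.errorProb (c n) + t n)) + 2 - t n * Real.logb 2 (t n)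
          + t n * (n * Real.logb 2 (Fintype.card E) + 1 / Real.log 2) := by
      field_simp
    rw [h3] at h2
    nlinarith
  obtain ⟨i, hi⟩ : ∃ i, RK - ε ≤ C.letterRate (c n) i := by
    by_contra! hlt
    have hne : (Finset.univ : Finset (Fin n)).Nonempty := ⟨⟨0, hn1⟩, Finset.mem_univ _⟩
    have := Finset.sum_lt_sum_of_nonempty hne fun i _ => hlt i
    rw [Finset.sum_const, Finset.card_univ, Fintype.card_fin, nsmul_eq_mul] at this
    linarith
  obtain ⟨z, hz, hzE, hzR⟩ := C.exists_letterRate_eq hM (c n) i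
  exact ⟨z, hz, fun e => by rw [hzE]; exact (habs i e).trans hn3, hzR ▸ hi⟩

end StateChannel

/-! ### Random coding -/

/-- A sum of independent variables deviates from its mean, on average, by at most the square root
of the sum of the second moments. -/
theorem sum_prod_mul_abs_sub_le {ι Y : Type*} [Fintype ι] [DecidableEq ι] [Fintype Y]
    {w : ι → Y → ℝ} (hw : ∀ i, w i ∈ stdSimplex ℝ Y) (f : ι → Y → ℝ) :
    ∑ y : ι → Y, (∏ j, w j (y j)) * |∑ i, f i (y i) - ∑ i, ∑ v, w i v * f i v|
      ≤ Real.sqrt (∑ i, ∑ v, w i v * f i v ^ 2) := by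
  have hw1 := fun i => (hw i).2
  have hmem : (fun y : ι → Y => ∏ j, w j (y j)) ∈ stdSimplex ℝ (ι → Y) :=
    ⟨fun y => Finset.prod_nonneg fun j _ => (hw j).1 _, sum_prod_eq_one hw1⟩
  refine (sum_mul_abs_le_sqrt hmem _).trans (Real.sqrt_le_sqrt ?_)
  have h := sum_prod_mul_sum_sq hw1 (fun i v => f i v - ∑ v, w i v * f i v) fun i => by
    simp_rw [mul_sub]
    rw [Finset.sum_sub_distrib, ← Finset.sum_mul, hw1, one_mul, sub_self]
  simp_rw [Finset.sum_sub_distrib] at h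
  rw [h]
  refine Finset.sum_le_sum fun i _ => ?_
  have : ∑ v, w i v * (f i v - ∑ v, w i v * f i v) ^ 2
      = ∑ v, w i v * f i v ^ 2 - (∑ v, w i v * f i v) ^ 2 := by
    set μ := ∑ v, w i v * f i v with hμ
    have h1 : ∀ v, w i v * (f i v - μ) ^ 2
        = w i v * f i v ^ 2 - 2 * μ * (w i v * f i v) + w i v * μ ^ 2 := fun v => by ring
    simp_rw [h1]
    rw [Finset.sum_add_distrib, Finset.sum_sub_distrib, ← Finset.mul_sum, ← Finset.sum_mul, hw1,
      ← hμ]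
    ring
  rw [this]
  exact sub_le_self _ (sq_nonneg _)

section OneShot

variable {S U B E : Type*} {J K : ℕ}

open Classical in
/-- The indicator that the density of the output `b` under the codeword `u` exceeds `θ` times its
average density under the state `s`. -/
def passes [Fintype U] (P : S → U → ℝ) (VB : U → S → B → ℝ) (θ : ℝ) (s : S) (b : B) (u : U) : ℝ :=
  if θ * ∑ u', P s u' * VB u' s b < VB u s b then 1 else 0

open Classical in
/-- The indicator that the output `e` of the warden is atypically likely under the pair of state
and codeword. -/
def leaks (q : S → ℝ) (VE : U → S → E → ℝ) (Q : E → ℝ) (γ : ℝ) (s : S) (u : U) (e : E) : ℝ :=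
  if γ * Q e < VE u s e * q s then 1 else 0

theorem passes_nonneg [Fintype U] (P : S → U → ℝ) (VB : U → S → B → ℝ) (θ : ℝ) (s : S) (b : B)
    (u : U) :
    0 ≤ passes P VB θ s b u := by
  unfold passes; split_ifs <;> norm_num

theorem leaks_nonneg (q : S → ℝ) (VE : U → S → E → ℝ) (Q : E → ℝ) (γ : ℝ) (s : S) (u : U)
    (e : E) : 0 ≤ leaks q VE Q γ s u e := by
  unfold leaks; split_ifs <;> norm_num

theorem leaks_le_one (q : S → ℝ) (VE : U → S → E → ℝ) (Q : E → ℝ) (γ : ℝ) (s : S) (u : U)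
    (e : E) : leaks q VE Q γ s u e ≤ 1 := by
  unfold leaks; split_ifs <;> norm_num

/-- The law of one letter of the random code: a codeword drawn from `P s` and an independent
uniform key. -/
def letterLaw (P : S → U → ℝ) (J K : ℕ) (x : S × Fin J) (v : U × Fin K) : ℝ :=
  P x.1 v.1 * (1 / (K : ℝ))

theorem letterLaw_mem [Fintype U] {P : S → U → ℝ} (hP : ∀ s, P s ∈ stdSimplex ℝ U) (hK : 1 ≤ K)
    (x : S × Fin J) : letterLaw P J K x ∈ stdSimplex ℝ (U × Fin K) := by
  have hK0 : (0 : ℝ) < K := by exact_mod_cast hK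
  refine ⟨fun v => mul_nonneg ((hP _).1 _) (by positivity), ?_⟩
  simp only [letterLaw, Fintype.sum_prod_type, Finset.sum_const, Finset.card_univ,
    Fintype.card_fin, nsmul_eq_mul]
  rw [← Finset.mul_sum, ← Finset.sum_mul, (hP _).2]
  field_simp

theorem sum_letterLaw_mul [Fintype U] (P : S → U → ℝ) (hK : 1 ≤ K) (x : S × Fin J) (g : U → ℝ) :
    ∑ v : U × Fin K, letterLaw P J K x v * g v.1 = ∑ u, P x.1 u * g u := by
  have hK0 : (0 : ℝ) < K := by exact_mod_cast hK
  simp only [letterLaw, Fintype.sum_prod_type, Finset.sum_const, Finset.card_univ,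
    Fintype.card_fin, nsmul_eq_mul]
  refine Finset.sum_congr rfl fun u _ => ?_
  field_simp

variable [Fintype S] [Fintype B] [Fintype E] [Fintype U]

open Classical in
/-- The union bound on the error probability of threshold decoding with the codebook `cb`: the sent
codeword fails the test or another one passes it. -/
def thresholdError (q : S → ℝ) (P : S → U → ℝ) (VB : U → S → B → ℝ) (θ : ℝ)
    (cb : S → Fin J → U) : ℝ :=
  ∑ s, ∑ j, ∑ b, q s / J * (VB (cb s j) s b *
    ((1 - passes P VB θ s b (cb s j)) + ∑ j' ∈ Finset.univ.erase j, passes P VB θ s b (cb s j')))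

open Classical in
/-- The joint law of the key and the output of the warden for the codebook `cb` and the key
assignment `h`. -/
def codebookLaw (q : S → ℝ) (VE : U → S → E → ℝ) (cb : S → Fin J → U) (h : S → Fin J → Fin K)
    (x : Fin K × E) : ℝ :=
  ∑ s, ∑ j, if h s j = x.1 then q s / J * VE (cb s j) s x.2 else 0

open Classical in
/-- The average over random codebooks of the error probability of threshold decoding. -/
theorem sum_thresholdError_le {q : S → ℝ} (hq : q ∈ stdSimplex ℝ S) {P : S → U → ℝ}
    (hP : ∀ s, P s ∈ stdSimplex ℝ U) {VB : U → S → B → ℝ}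
    (hVB : ∀ u s, VB u s ∈ stdSimplex ℝ B) (hJ : 1 ≤ J) (hK : 1 ≤ K) {θ : ℝ} (hθ : 0 < θ) :
    ∑ c : S × Fin J → U × Fin K, (∏ x, letterLaw P J K x (c x)) *
        thresholdError q P VB θ (fun s j => (c (s, j)).1)
      ≤ (∑ s, ∑ u, ∑ b, q s * P s u * VB u s b * (1 - passes P VB θ s b u)) + (J - 1) / θ := by
  have hJ0 : (0 : ℝ) < J := by exact_mod_cast hJ
  have hw1 : ∀ x : S × Fin J, ∑ v, letterLaw P J K x v = 1 := fun x => (letterLaw_mem hP hK x).2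
  have e1 : ∀ s (j : Fin J) b, ∑ c : S × Fin J → U × Fin K, (∏ x, letterLaw P J K x (c x)) *
      (VB (c (s, j)).1 s b * (1 - passes P VB θ s b (c (s, j)).1))
      = ∑ u, P s u * (VB u s b * (1 - passes P VB θ s b u)) := by
    intro s j b
    rw [sum_prod_mul_coord hw1 (s, j) fun v => VB v.1 s b * (1 - passes P VB θ s b v.1)]
    exact sum_letterLaw_mul P hK (s, j) fun u => VB u s b * (1 - passes P VB θ s b u)
  have e2 : ∀ s (j j' : Fin J) b, j' ≠ j → ∑ c : S × Fin J → U × Fin K,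
      (∏ x, letterLaw P J K x (c x)) * (VB (c (s, j)).1 s b * passes P VB θ s b (c (s, j')).1)
      ≤ ∑ u, P s u * VB u s b / θ := by
    intro s j j' b hj
    rw [sum_prod_mul_two_coord hw1 (i := (s, j)) (j := (s, j')) (by simpa using hj.symm)
      (fun v => VB v.1 s b) fun v => passes P VB θ s b v.1,
      sum_letterLaw_mul P hK (s, j) fun u => VB u s b,
      sum_letterLaw_mul P hK (s, j') fun u => passes P VB θ s b u, Finset.mul_sum]
    refine Finset.sum_le_sum fun u _ => ?_
    -- a codeword that passes the test has a density above `θ` times the average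
    unfold passes
    split_ifs with h
    · rw [mul_one, mul_comm, mul_div_assoc]
      refine mul_le_mul_of_nonneg_left ?_ ((hP s).1 u)
      rw [le_div_iff₀ hθ, mul_comm]
      exact h.le
    · rw [mul_zero, mul_zero]
      exact div_nonneg (mul_nonneg ((hP s).1 u) ((hVB u s).1 b)) hθ.le
  have e3 : ∀ s (j : Fin J), ∑ c : S × Fin J → U × Fin K, (∏ x, letterLaw P J K x (c x)) *
      (∑ b, q s / J * (VB (c (s, j)).1 s b * ((1 - passes P VB θ s b (c (s, j)).1)
        + ∑ j' ∈ Finset.univ.erase j, passes P VB θ s b (c (s, j')).1)))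
      ≤ q s / J * ((∑ u, ∑ b, P s u * (VB u s b * (1 - passes P VB θ s b u))) + (J - 1) / θ) := by
    intro s j
    have h1 : ∀ c : S × Fin J → U × Fin K, (∏ x, letterLaw P J K x (c x)) *
      (∑ b, q s / J * (VB (c (s, j)).1 s b * ((1 - passes P VB θ s b (c (s, j)).1)
        + ∑ j' ∈ Finset.univ.erase j, passes P VB θ s b (c (s, j')).1)))
      = q s / J * ((∑ b, (∏ x, letterLaw P J K x (c x)) *
          (VB (c (s, j)).1 s b * (1 - passes P VB θ s b (c (s, j)).1)))
        + ∑ b, ∑ j' ∈ Finset.univ.erase j, (∏ x, letterLaw P J K x (c x)) *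
          (VB (c (s, j)).1 s b * passes P VB θ s b (c (s, j')).1)) := by
      intro c
      simp only [← Finset.mul_sum]
      rw [← mul_add, ← Finset.sum_add_distrib]
      simp only [mul_add]
      ring
    simp_rw [h1]
    rw [← Finset.mul_sum, Finset.sum_add_distrib]
    refine mul_le_mul_of_nonneg_left (add_le_add ?_ ?_) (div_nonneg (hq.1 s) hJ0.le)
    · rw [Finset.sum_comm]
      simp_rw [e1]
      rw [Finset.sum_comm]
    · rw [Finset.sum_comm]
      have h2 : ∀ b, ∑ c : S × Fin J → U × Fin K, ∑ j' ∈ Finset.univ.erase j,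
          (∏ x, letterLaw P J K x (c x)) *
            (VB (c (s, j)).1 s b * passes P VB θ s b (c (s, j')).1)
          ≤ (J - 1) * ∑ u, P s u * VB u s b / θ := by
        intro b
        rw [Finset.sum_comm]
        refine (Finset.sum_le_sum fun j' hj' => e2 s j j' b (Finset.ne_of_mem_erase hj')).trans ?_
        rw [Finset.sum_const, Finset.card_erase_of_mem (Finset.mem_univ _), Finset.card_univ,
          Fintype.card_fin, nsmul_eq_mul, Nat.cast_sub hJ, Nat.cast_one]
      refine (Finset.sum_le_sum fun b _ => h2 b).trans (le_of_eq ?_)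
      rw [← Finset.mul_sum, Finset.sum_comm]
      simp_rw [← Finset.sum_div, ← Finset.mul_sum, (hVB _ _).2, mul_one, (hP s).2]
      ring
  unfold thresholdError
  have h3 : ∀ c : S × Fin J → U × Fin K, (∏ x, letterLaw P J K x (c x)) *
      (∑ s, ∑ j, ∑ b, q s / J * (VB (c (s, j)).1 s b * ((1 - passes P VB θ s b (c (s, j)).1)
        + ∑ j' ∈ Finset.univ.erase j, passes P VB θ s b (c (s, j')).1)))
      = ∑ s, ∑ j, (∏ x, letterLaw P J K x (c x)) *
      (∑ b, q s / J * (VB (c (s, j)).1 s b * ((1 - passes P VB θ s b (c (s, j)).1)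
        + ∑ j' ∈ Finset.univ.erase j, passes P VB θ s b (c (s, j')).1))) := by
    intro c
    rw [Finset.mul_sum]
    exact Finset.sum_congr rfl fun s _ => Finset.mul_sum _ _ _
  simp_rw [h3]
  rw [Finset.sum_comm]
  have h4 : ∀ s, ∑ c : S × Fin J → U × Fin K, ∑ j, (∏ x, letterLaw P J K x (c x)) *
      (∑ b, q s / J * (VB (c (s, j)).1 s b * ((1 - passes P VB θ s b (c (s, j)).1)
        + ∑ j' ∈ Finset.univ.erase j, passes P VB θ s b (c (s, j')).1)))
      ≤ q s * ((∑ u, ∑ b, P s u * (VB u s b * (1 - passes P VB θ s b u))) + (J - 1) / θ) := by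
    intro s
    rw [Finset.sum_comm]
    refine (Finset.sum_le_sum fun j _ => e3 s j).trans (le_of_eq ?_)
    rw [Finset.sum_const, Finset.card_univ, Fintype.card_fin, nsmul_eq_mul]
    field_simp
  refine (Finset.sum_le_sum fun s _ => h4 s).trans (le_of_eq ?_)
  simp_rw [mul_add]
  rw [Finset.sum_add_distrib, ← Finset.sum_mul, hq.2, one_mul]
  simp only [Finset.mul_sum, mul_assoc]

open Classical in
/-- Soft covering: the average over random codebooks of the distance of the joint law of key and
warden output from the ideal one. Distinct codewords are independent, so only the second moments
of the single contributions enter. -/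
theorem sum_codebookLaw_dist_le {q : S → ℝ} (hq : q ∈ stdSimplex ℝ S) {P : S → U → ℝ}
    (hP : ∀ s, P s ∈ stdSimplex ℝ U) {VE : U → S → E → ℝ}
    (hVE : ∀ u s, VE u s ∈ stdSimplex ℝ E) {Q : E → ℝ}
    (hQ : ∀ e, Q e = ∑ s, ∑ u, q s * P s u * VE u s e) (hQ1 : Q ∈ stdSimplex ℝ E)
    (hJ : 1 ≤ J) (hK : 1 ≤ K) {γ : ℝ} (hγ : 0 ≤ γ) :
    ∑ c : S × Fin J → U × Fin K, (∏ x, letterLaw P J K x (c x)) *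
        ∑ x : Fin K × E, |codebookLaw q VE (fun s j => (c (s, j)).1) (fun s j => (c (s, j)).2) x
          - 1 / K * Q x.2|
      ≤ Real.sqrt (γ * K / J) +
        2 * ∑ s, ∑ u, ∑ e, q s * P s u * VE u s e * leaks q VE Q γ s u e := by
  have hJ0 : (0 : ℝ) < J := by exact_mod_cast hJ
  have hK0 : (0 : ℝ) < K := by exact_mod_cast hK
  have hw : ∀ x : S × Fin J, letterLaw P J K x ∈ stdSimplex ℝ (U × Fin K) := letterLaw_mem hP hK
  have hw1 := fun x => (hw x).2
  -- The contribution of one codeword is split into a typical and an atypical part.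
  let f : E → Fin K → S × Fin J → U × Fin K → ℝ := fun e k x v =>
    if v.2 = k then q x.1 / J * VE v.1 x.1 e * (1 - leaks q VE Q γ x.1 v.1 e) else 0
  let g : E → Fin K → S × Fin J → U × Fin K → ℝ := fun e k x v =>
    if v.2 = k then q x.1 / J * VE v.1 x.1 e * leaks q VE Q γ x.1 v.1 e else 0
  have hg0 : ∀ e k x v, 0 ≤ g e k x v := by
    intro e k x v
    simp only [g]
    split_ifs
    · exact mul_nonneg (mul_nonneg (div_nonneg (hq.1 _) hJ0.le) ((hVE _ _).1 _))
        (leaks_nonneg _ _ _ _ _ _ _)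
    · exact le_rfl
  have hfg : ∀ (c : S × Fin J → U × Fin K) (x : Fin K × E),
      codebookLaw q VE (fun s j => (c (s, j)).1) (fun s j => (c (s, j)).2) x
        = ∑ y, f x.2 x.1 y (c y) + ∑ y, g x.2 x.1 y (c y) := by
    intro c x
    rw [← Finset.sum_add_distrib, Fintype.sum_prod_type, codebookLaw]
    refine Finset.sum_congr rfl fun s _ => Finset.sum_congr rfl fun j _ => ?_
    simp only [f, g]
    split_ifs
    · ring
    · ring
  -- Expectations of a function of codeword and key that vanishes off one key.
  have hmean : ∀ (k : Fin K) (x : S × Fin J) (χ : U → ℝ),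
      ∑ v, letterLaw P J K x v * (if v.2 = k then χ v.1 else 0)
        = 1 / K * ∑ u, P x.1 u * χ u := by
    intro k x χ
    simp only [letterLaw, Fintype.sum_prod_type, mul_ite, mul_zero, Finset.sum_ite_eq',
      Finset.mem_univ, if_true, Finset.mul_sum]
    exact Finset.sum_congr rfl fun u _ => by ring
  let β : E → ℝ := fun e => ∑ s, ∑ u, q s * P s u * VE u s e * leaks q VE Q γ s u e
  have hgmean : ∀ e k, ∑ y, ∑ v, letterLaw P J K y v * g e k y v = 1 / K * β e := by
    intro e k
    have h1 : ∀ y, ∑ v, letterLaw P J K y v * g e k y v = 1 / K * ∑ u, P y.1 u *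
        (q y.1 / J * VE u y.1 e * leaks q VE Q γ y.1 u e) := fun y =>
      hmean k y fun u => q y.1 / J * VE u y.1 e * leaks q VE Q γ y.1 u e
    simp_rw [h1]
    rw [Fintype.sum_prod_type]
    simp only [Finset.sum_const, Finset.card_univ, Fintype.card_fin, nsmul_eq_mul, β,
      Finset.mul_sum]
    refine Finset.sum_congr rfl fun s _ => Finset.sum_congr rfl fun u _ => ?_
    field_simp
  have hfmean : ∀ e k, ∑ y, ∑ v, letterLaw P J K y v * f e k y v = 1 / K * (Q e - β e) := by
    intro e k
    have h1 : ∀ y, ∑ v, letterLaw P J K y v * f e k y v = 1 / K * ∑ u, P y.1 u *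
        (q y.1 / J * VE u y.1 e * (1 - leaks q VE Q γ y.1 u e)) := fun y =>
      hmean k y fun u => q y.1 / J * VE u y.1 e * (1 - leaks q VE Q γ y.1 u e)
    simp_rw [h1]
    rw [Fintype.sum_prod_type]
    simp only [Finset.sum_const, Finset.card_univ, Fintype.card_fin, nsmul_eq_mul, β, hQ e]
    rw [← Finset.sum_sub_distrib, Finset.mul_sum]
    refine Finset.sum_congr rfl fun s _ => ?_
    rw [← Finset.sum_sub_distrib, Finset.mul_sum, Finset.mul_sum, Finset.mul_sum]
    refine Finset.sum_congr rfl fun u _ => ?_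
    field_simp
  have hsq : ∀ e k, ∑ y, ∑ v, letterLaw P J K y v * f e k y v ^ 2 ≤ γ / (J * K) * Q e ^ 2 := by
    intro e k
    have h1 : ∀ y, ∑ v, letterLaw P J K y v * f e k y v ^ 2
        ≤ 1 / K * ∑ u, P y.1 u * (q y.1 * VE u y.1 e * (γ * Q e) / J ^ 2) := by
      intro y
      rw [← hmean k]
      refine Finset.sum_le_sum fun v _ => mul_le_mul_of_nonneg_left ?_ ((hw y).1 v)
      simp only [f]
      have h0 : 0 ≤ q y.1 * VE v.1 y.1 e := mul_nonneg (hq.1 _) ((hVE _ _).1 _)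
      split_ifs
      · unfold leaks
        split_ifs with h2
        · simp only [sub_self, mul_zero, ne_eq, OfNat.ofNat_ne_zero, not_false_eq_true, zero_pow]
          exact div_nonneg (mul_nonneg h0 (mul_nonneg hγ (hQ1.1 e))) (sq_nonneg _)
        · rw [not_lt, mul_comm (VE v.1 y.1 e)] at h2
          have h3 : (q y.1 / J * VE v.1 y.1 e * (1 - 0)) ^ 2
              = (q y.1 * VE v.1 y.1 e) * (q y.1 * VE v.1 y.1 e) / J ^ 2 := by
            field_simp
            ring
          rw [h3]
          exact div_le_div_of_nonneg_right (mul_le_mul_of_nonneg_left h2 h0) (sq_nonneg _)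
      · simp
    refine (Finset.sum_le_sum fun y _ => h1 y).trans (le_of_eq ?_)
    rw [Fintype.sum_prod_type]
    simp only [Finset.sum_const, Finset.card_univ, Fintype.card_fin, nsmul_eq_mul]
    have h4 : ∀ s, (J : ℝ) * (1 / K * ∑ u, P s u * (q s * VE u s e * (γ * Q e) / J ^ 2))
        = (γ / (J * K) * Q e) * ∑ u, q s * P s u * VE u s e := by
      intro s
      rw [Finset.mul_sum, Finset.mul_sum, Finset.mul_sum]
      refine Finset.sum_congr rfl fun u _ => ?_
      field_simp
    simp_rw [h4]
    rw [← Finset.mul_sum, ← hQ e]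
    ring
  have hdev : ∀ e k, ∑ c : S × Fin J → U × Fin K, (∏ x, letterLaw P J K x (c x)) *
      |∑ y, f e k y (c y) - 1 / K * (Q e - β e)| ≤ Real.sqrt (γ / (J * K)) * Q e := by
    intro e k
    rw [← hfmean e k]
    refine (sum_prod_mul_abs_sub_le hw (f e k)).trans ((Real.sqrt_le_sqrt (hsq e k)).trans ?_)
    rw [Real.sqrt_mul (by positivity), Real.sqrt_sq (hQ1.1 e)]
  have hrest : ∀ e k, ∑ c : S × Fin J → U × Fin K, (∏ x, letterLaw P J K x (c x)) *
      ∑ y, g e k y (c y) = 1 / K * β e := by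
    intro e k
    simp_rw [Finset.mul_sum]
    rw [Finset.sum_comm, ← hgmean e k]
    exact Finset.sum_congr rfl fun y _ => sum_prod_mul_coord hw1 y (g e k y)
  have hβ : ∀ e, 0 ≤ β e := fun e => Finset.sum_nonneg fun s _ => Finset.sum_nonneg fun u _ =>
    mul_nonneg (mul_nonneg (mul_nonneg (hq.1 _) ((hP _).1 _)) ((hVE _ _).1 _))
      (leaks_nonneg _ _ _ _ _ _ _)
  have hpoint : ∀ x : Fin K × E, ∑ c : S × Fin J → U × Fin K, (∏ x, letterLaw P J K x (c x)) *
      |codebookLaw q VE (fun s j => (c (s, j)).1) (fun s j => (c (s, j)).2) x - 1 / K * Q x.2|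
      ≤ Real.sqrt (γ / (J * K)) * Q x.2 + 2 * (1 / K * β x.2) := by
    intro x
    have h1 : ∀ c : S × Fin J → U × Fin K, (∏ x, letterLaw P J K x (c x)) *
        |codebookLaw q VE (fun s j => (c (s, j)).1) (fun s j => (c (s, j)).2) x - 1 / K * Q x.2|
        ≤ (∏ x, letterLaw P J K x (c x)) * |∑ y, f x.2 x.1 y (c y) - 1 / K * (Q x.2 - β x.2)|
          + (∏ x, letterLaw P J K x (c x)) * ∑ y, g x.2 x.1 y (c y)
          + (∏ x, letterLaw P J K x (c x)) * (1 / K * β x.2) := by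
      intro c
      rw [← mul_add, ← mul_add]
      refine mul_le_mul_of_nonneg_left ?_ (Finset.prod_nonneg fun y _ => (hw y).1 _)
      rw [hfg c x]
      have h2 : 0 ≤ ∑ y, g x.2 x.1 y (c y) := Finset.sum_nonneg fun y _ => hg0 _ _ _ _
      have h3 : 0 ≤ 1 / (K : ℝ) * β x.2 := mul_nonneg (by positivity) (hβ _)
      rw [abs_le]
      constructor
      · have := neg_abs_le (∑ y, f x.2 x.1 y (c y) - 1 / K * (Q x.2 - β x.2))
        linarith
      · have := le_abs_self (∑ y, f x.2 x.1 y (c y) - 1 / K * (Q x.2 - β x.2))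
        linarith
    refine (Finset.sum_le_sum fun c _ => h1 c).trans ?_
    rw [Finset.sum_add_distrib, Finset.sum_add_distrib, hrest, ← Finset.sum_mul,
      sum_prod_eq_one hw1]
    have := hdev x.2 x.1
    linarith
  simp_rw [Finset.mul_sum]
  rw [Finset.sum_comm]
  refine (Finset.sum_le_sum fun x _ => hpoint x).trans (le_of_eq ?_)
  rw [Finset.sum_add_distrib, Fintype.sum_prod_type, Fintype.sum_prod_type]
  simp only [Finset.sum_const, Finset.card_univ, Fintype.card_fin, nsmul_eq_mul, ← Finset.mul_sum,
    hQ1.2, mul_one]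
  congr 1
  · rw [show γ * (K : ℝ) / J = (γ / (J * K)) * (K : ℝ) ^ 2 by field_simp,
      Real.sqrt_mul (by positivity), Real.sqrt_sq hK0.le, mul_comm]
  · have : ∑ e, β e = ∑ s, ∑ u, ∑ e, q s * P s u * VE u s e * leaks q VE Q γ s u e := by
      simp only [β]
      rw [Finset.sum_comm]
      exact Finset.sum_congr rfl fun s _ => Finset.sum_comm
    rw [this]
    field_simp

/-- Some codebook is at least as good as the average one, for decoding and for secrecy at once. -/
theorem exists_codebook {q : S → ℝ} (hq : q ∈ stdSimplex ℝ S) {P : S → U → ℝ}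
    (hP : ∀ s, P s ∈ stdSimplex ℝ U) {VB : U → S → B → ℝ}
    (hVB : ∀ u s, VB u s ∈ stdSimplex ℝ B) {VE : U → S → E → ℝ}
    (hVE : ∀ u s, VE u s ∈ stdSimplex ℝ E) {Q : E → ℝ}
    (hQ : ∀ e, Q e = ∑ s, ∑ u, q s * P s u * VE u s e) (hQ1 : Q ∈ stdSimplex ℝ E)
    (hJ : 1 ≤ J) (hK : 1 ≤ K) {γ θ : ℝ} (hγ : 0 ≤ γ) (hθ : 0 < θ) :
    ∃ (cb : S → Fin J → U) (h : S → Fin J → Fin K),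
      thresholdError q P VB θ cb +
        tvDist (codebookLaw q VE cb h) (fun x => 1 / K * Q x.2)
      ≤ (∑ s, ∑ u, ∑ b, q s * P s u * VB u s b * (1 - passes P VB θ s b u)) + (J - 1) / θ
        + (∑ s, ∑ u, ∑ e, q s * P s u * VE u s e * leaks q VE Q γ s u e)
        + Real.sqrt (γ * K / J) / 2 := by
  classical
  have hw : ∀ x : S × Fin J, letterLaw P J K x ∈ stdSimplex ℝ (U × Fin K) := letterLaw_mem hP hK
  have hmem : (fun c : S × Fin J → U × Fin K => ∏ x, letterLaw P J K x (c x))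
      ∈ stdSimplex ℝ (S × Fin J → U × Fin K) :=
    ⟨fun y => Finset.prod_nonneg fun j _ => (hw j).1 _, sum_prod_eq_one fun x => (hw x).2⟩
  have h1 := sum_thresholdError_le hq hP hVB hJ hK hθ
  have h2 := sum_codebookLaw_dist_le hq hP hVE hQ hQ1 hJ hK hγ
  obtain ⟨c, hc⟩ := exists_le_of_sum_mul_le hmem
    (F := fun c => thresholdError q P VB θ (fun s j => (c (s, j)).1) + 1 / 2 *
      ∑ x : Fin K × E, |codebookLaw q VE (fun s j => (c (s, j)).1) (fun s j => (c (s, j)).2) x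
          - 1 / K * Q x.2|)
    (b := (∑ s, ∑ u, ∑ b, q s * P s u * VB u s b * (1 - passes P VB θ s b u)) + (J - 1) / θ
        + (∑ s, ∑ u, ∑ e, q s * P s u * VE u s e * leaks q VE Q γ s u e)
        + Real.sqrt (γ * K / J) / 2) (by
      have h3 : ∀ a b d : ℝ, a * (b + 1 / 2 * d) = a * b + 1 / 2 * (a * d) := fun a b d => by ring
      simp only [h3]
      rw [Finset.sum_add_distrib, ← Finset.mul_sum]
      linarith)
  exact ⟨fun s j => (c (s, j)).1, fun s j => (c (s, j)).2, hc⟩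

end OneShot

/-! ### Achievability -/

theorem sum_prod_eq_prod_sum {n : ℕ} {Y : Type*} [Fintype Y] (f : Fin n → Y → ℝ) :
    ∑ y : Fin n → Y, ∏ i, f i (y i) = ∏ i, ∑ v, f i v := by
  rw [Finset.prod_univ_sum, Fintype.piFinset_univ]

theorem prod_mem_stdSimplex {n : ℕ} {Y : Type*} [Fintype Y] {w : Fin n → Y → ℝ}
    (hw : ∀ i, w i ∈ stdSimplex ℝ Y) :
    (fun y : Fin n → Y => ∏ i, w i (y i)) ∈ stdSimplex ℝ (Fin n → Y) :=
  ⟨fun _ => Finset.prod_nonneg fun i _ => (hw i).1 _, sum_prod_eq_one fun i => (hw i).2⟩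

theorem sum_sum_sum_eq_sum_triple {n : ℕ} {S U B : Type*} [Fintype S] [Fintype U] [Fintype B]
    (F : (Fin n → S) → (Fin n → U) → (Fin n → B) → ℝ) :
    ∑ s, ∑ u, ∑ b, F s u b = ∑ z : Fin n → U × B × S,
      F (fun i => (z i).2.2) (fun i => (z i).1) fun i => (z i).2.1 := by
  rw [← sum_sum_eq_sum_pair fun (u : Fin n → U) (y : Fin n → B × S) =>
    F (fun i => (y i).2) u fun i => (y i).1, Finset.sum_comm]
  refine Finset.sum_congr rfl fun u _ => ?_
  rw [← sum_sum_eq_sum_pair fun (b : Fin n → B) (s : Fin n → S) => F s u b, Finset.sum_comm]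

/-- The weak law of large numbers for a likelihood ratio: `g` stands for an event on which the
ratio of `∏ x` to `∏ y` falls short of its typical exponent by `n * δ`. -/
theorem sum_prod_ratio_le {Y : Type*} [Fintype Y] {w : Y → ℝ} (hw : w ∈ stdSimplex ℝ Y)
    {x y : Y → ℝ} (hx : ∀ v, 0 < w v → 0 < x v) (hy : ∀ v, 0 < w v → 0 < y v) {δ : ℝ}
    (hδ : 0 < δ) {n : ℕ} (hn : n ≠ 0) {g : (Fin n → Y) → ℝ} (hg1 : ∀ z, g z ≤ 1)
    (hg : ∀ z, (2 : ℝ) ^ ((n : ℝ) * (∑ v, w v * Real.logb 2 (x v / y v) - δ)) * ∏ i, y (z i)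
      < ∏ i, x (z i) → g z ≤ 0) :
    ∑ z : Fin n → Y, (∏ i, w (z i)) * g z
      ≤ (∑ v, w v * (Real.logb 2 (x v / y v) - ∑ v, w v * Real.logb 2 (x v / y v)) ^ 2)
        / δ ^ 2 / n := by
  refine le_trans (Finset.sum_le_sum fun z _ => ?_)
    (sum_prod_deviation_le hw (fun v => Real.logb 2 (x v / y v)) hδ hn)
  set μ := ∑ v, w v * Real.logb 2 (x v / y v)
  rcases (Finset.prod_nonneg fun i (_ : i ∈ Finset.univ) => hw.1 (z i)).eq_or_lt with h0 | h0
  · rw [← h0, zero_mul, zero_mul]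
  refine mul_le_mul_of_nonneg_left ?_ h0.le
  split_ifs with h
  · exact hg1 z
  refine hg z ?_
  by_contra! hle
  refine h ?_
  have hpos : ∀ i, 0 < w (z i) := fun i => (hw.1 _).lt_of_ne' fun h1 =>
    h0.ne' (Finset.prod_eq_zero (Finset.mem_univ i) h1)
  have hx' : ∀ i, 0 < x (z i) := fun i => hx _ (hpos i)
  have hy' : ∀ i, 0 < y (z i) := fun i => hy _ (hpos i)
  have h1 := Real.logb_le_logb_of_le (b := 2) (by norm_num)
    (Finset.prod_pos fun i _ => hx' i) hle
  rw [Real.logb_mul (by positivity) (Finset.prod_pos fun i _ => hy' i).ne',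
    Real.logb_rpow (by norm_num) (by norm_num)] at h1
  have hlog : ∀ {r : Fin n → ℝ}, (∀ i, 0 < r i) →
      Real.logb 2 (∏ i, r i) = ∑ i, Real.logb 2 (r i) := fun {r} hr => by
    simp only [Real.logb]
    rw [Real.log_prod fun i _ => (hr i).ne', Finset.sum_div]
  rw [hlog hx', hlog hy'] at h1
  have h2 : ∑ i, (Real.logb 2 (x (z i) / y (z i)) - μ)
      = ∑ i, Real.logb 2 (x (z i)) - ∑ i, Real.logb 2 (y (z i)) - n * μ := by
    rw [Finset.sum_sub_distrib, Finset.sum_const, Finset.card_univ, Fintype.card_fin,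
      nsmul_eq_mul, ← Finset.sum_sub_distrib]
    congr 1
    exact Finset.sum_congr rfl fun i _ => Real.logb_div (hx' i).ne' (hy' i).ne'
  rw [h2]
  refine le_trans ?_ (neg_le_abs _)
  linarith

/-- A decision rule for indicators `g` that is wrong only when the true index fails its test or
another index passes its test. -/
theorem exists_threshold_decision {J : ℕ} (hJ : 1 ≤ J) {g : Fin J → ℝ}
    (hg : ∀ j, g j = 0 ∨ g j = 1) :
    ∃ j₀, ∀ j, (if j₀ = j then 0 else 1) ≤ (1 - g j) + ∑ j' ∈ Finset.univ.erase j, g j' := by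
  have h0 : ∀ j, 0 ≤ g j := fun j => by rcases hg j with h | h <;> rw [h]; norm_num
  have h1 : ∀ j, g j ≤ 1 := fun j => by rcases hg j with h | h <;> rw [h]; norm_num
  by_cases hex : ∃ j₀, g j₀ = 1
  · obtain ⟨j₀, hj₀⟩ := hex
    refine ⟨j₀, fun j => ?_⟩
    have hs := Finset.sum_nonneg fun j' (_ : j' ∈ Finset.univ.erase j) => h0 j'
    split_ifs with h
    · linarith [h1 j]
    · have := Finset.single_le_sum (f := g) (fun j' _ => h0 j')
        (Finset.mem_erase.2 ⟨h, Finset.mem_univ j₀⟩)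
      linarith [h1 j]
  · refine ⟨⟨0, hJ⟩, fun j => ?_⟩
    have hs := Finset.sum_nonneg fun j' (_ : j' ∈ Finset.univ.erase j) => h0 j'
    have hj : g j = 0 := (hg j).resolve_right fun h => hex ⟨j, h⟩
    rw [hj]
    split_ifs <;> linarith

namespace StateChannel

variable {S A B E : Type*} [Fintype S] [Fintype A] [Fintype B] [Fintype E]
  (C : StateChannel S A B E)

section Letters

variable {U : Type*}

/-- The transition law from the auxiliary letter and the state to the output of the receiver. -/
def bobLetter (PA : U → S → A → ℝ) (u : U) (s : S) (b : B) : ℝ :=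
  ∑ a, ∑ e, PA u s a * C.W a s (b, e)

/-- The transition law from the auxiliary letter and the state to the output of the warden. -/
def wardenLetter (PA : U → S → A → ℝ) (u : U) (s : S) (e : E) : ℝ :=
  ∑ a, ∑ b, PA u s a * C.W a s (b, e)

theorem bobLetter_mem {PA : U → S → A → ℝ} (hPA : ∀ u s, PA u s ∈ stdSimplex ℝ A) (u : U)
    (s : S) : C.bobLetter PA u s ∈ stdSimplex ℝ B := by
  refine ⟨fun b => Finset.sum_nonneg fun a _ => Finset.sum_nonneg fun e _ =>
    mul_nonneg ((hPA _ _).1 _) ((C.W_mem _ _).1 _), ?_⟩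
  simp only [bobLetter]
  rw [Finset.sum_comm]
  simp_rw [← Finset.mul_sum, C.sum_W, mul_one, (hPA _ _).2]

theorem wardenLetter_mem {PA : U → S → A → ℝ} (hPA : ∀ u s, PA u s ∈ stdSimplex ℝ A) (u : U)
    (s : S) : C.wardenLetter PA u s ∈ stdSimplex ℝ E := by
  refine ⟨fun b => Finset.sum_nonneg fun a _ => Finset.sum_nonneg fun e _ =>
    mul_nonneg ((hPA _ _).1 _) ((C.W_mem _ _).1 _), ?_⟩
  simp only [wardenLetter]
  rw [Finset.sum_comm]
  simp_rw [← Finset.mul_sum, C.sum_W', mul_one, (hPA _ _).2]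

theorem sum_block_bob {n : ℕ} (PA : U → S → A → ℝ) (u : Fin n → U) (s : Fin n → S)
    (b : Fin n → B) :
    ∑ a : Fin n → A, ∑ e : Fin n → E, (∏ i, PA (u i) (s i) (a i)) *
        ∏ i, C.W (a i) (s i) (b i, e i) = ∏ i, C.bobLetter PA (u i) (s i) (b i) := by
  rw [sum_sum_eq_sum_pair fun a e => (∏ i, PA (u i) (s i) (a i)) *
        ∏ i, C.W (a i) (s i) (b i, e i)]
  simp_rw [← Finset.prod_mul_distrib]
  rw [sum_prod_eq_prod_sum fun i (v : A × E) => PA (u i) (s i) v.1 * C.W v.1 (s i) (b i, v.2)]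
  simp only [Fintype.sum_prod_type, bobLetter]

theorem sum_block_warden {n : ℕ} (PA : U → S → A → ℝ) (u : Fin n → U) (s : Fin n → S)
    (e : Fin n → E) :
    ∑ a : Fin n → A, ∑ b : Fin n → B, (∏ i, PA (u i) (s i) (a i)) *
        ∏ i, C.W (a i) (s i) (b i, e i) = ∏ i, C.wardenLetter PA (u i) (s i) (e i) := by
  rw [sum_sum_eq_sum_pair fun a b => (∏ i, PA (u i) (s i) (a i)) *
        ∏ i, C.W (a i) (s i) (b i, e i)]
  simp_rw [← Finset.prod_mul_distrib]
  rw [sum_prod_eq_prod_sum fun i (v : A × B) => PA (u i) (s i) v.1 * C.W v.1 (s i) (v.2, e i)]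
  simp only [Fintype.sum_prod_type, wardenLetter]

end Letters

section Construction

variable {U : Type*} {n J K : ℕ}

/-- The code with a single message that draws a codeword index `j` uniformly, sends the codeword
`cb s j` through the prefix channel `PA` and forms the key `h s j`; the receiver estimates the
index by `dj` and announces the key of the estimated index. -/
def codebookCode {PA : U → S → A → ℝ} (hPA : ∀ u s, PA u s ∈ stdSimplex ℝ A) (hJ : 1 ≤ J)
    (cb : (Fin n → S) → Fin J → Fin n → U) (h : (Fin n → S) → Fin J → Fin K)
    (dj : (Fin n → S) → (Fin n → B) → Fin J) : Code S A B n 1 K where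
  enc _ s x := ∑ j, 1 / (J : ℝ) *
    if h s j = x.2 then ∏ i, PA (cb s j i) (s i) (x.1 i) else 0
  enc_mem _ s := by
    have hJ0 : (0 : ℝ) < J := by exact_mod_cast hJ
    refine ⟨fun x => Finset.sum_nonneg fun j _ => mul_nonneg (by positivity) ?_, ?_⟩
    · split_ifs
      exacts [Finset.prod_nonneg fun i _ => (hPA _ _).1 _, le_rfl]
    · rw [Finset.sum_comm]
      have h1 : ∀ j, ∑ x : (Fin n → A) × Fin K, 1 / (J : ℝ) *
          (if h s j = x.2 then ∏ i, PA (cb s j i) (s i) (x.1 i) else 0) = 1 / J := by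
        intro j
        rw [← Finset.mul_sum, Fintype.sum_prod_type]
        simp only [Finset.sum_ite_eq, Finset.mem_univ, if_true]
        rw [sum_prod_eq_one (w := fun i => PA (cb s j i) (s i)) fun i => (hPA _ _).2, mul_one]
      simp_rw [h1]
      simp [hJ0.ne']
  dec b s x := if x.2 = h s (dj s b) then 1 else 0
  dec_mem b s := by
    refine ⟨fun x => ?_, ?_⟩
    · dsimp only
      split_ifs <;> norm_num
    · rw [Fintype.sum_prod_type]
      simp

variable {PA : U → S → A → ℝ} (hPA : ∀ u s, PA u s ∈ stdSimplex ℝ A) (hJ : 1 ≤ J)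
    (cb : (Fin n → S) → Fin J → Fin n → U) (h : (Fin n → S) → Fin J → Fin K)
    (dj : (Fin n → S) → (Fin n → B) → Fin J)

theorem errorProb_codebookCode :
    C.errorProb (codebookCode hPA hJ cb h dj) = ∑ s : Fin n → S, ∑ j, ∑ b : Fin n → B,
      (∏ i, C.QS (s i)) / J * ((∏ i, C.bobLetter PA (cb s j i) (s i) (b i)) *
        if h s j = h s (dj s b) then 0 else 1) := by
  rw [errorProb_eq_sum, Fin.sum_univ_one]
  refine Finset.sum_congr rfl fun s _ => ?_
  have h1 : ∀ (a : Fin n → A) (b : Fin n → B) (e : Fin n → E), ∑ k,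
      C.codeLaw (codebookCode hPA hJ cb h dj) 0 s a k b e *
      (1 - (codebookCode hPA hJ cb h dj).dec b s (0, k))
      = ∑ j, (∏ i, C.QS (s i)) / J * (((∏ i, PA (cb s j i) (s i) (a i)) *
        ∏ i, C.W (a i) (s i) (b i, e i)) * if h s j = h s (dj s b) then 0 else 1) := by
    intro a b e
    simp only [codeLaw, codebookCode, Finset.mul_sum, Finset.sum_mul]
    rw [Finset.sum_comm]
    refine Finset.sum_congr rfl fun j _ => ?_
    rw [Finset.sum_eq_single (h s j)]
    · rw [if_pos rfl]
      split_ifs <;> simp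
      ring
    · intro k _ hk
      simp [hk.symm]
    · simp
  have h2 : ∀ a : Fin n → A, ∑ k, ∑ b : Fin n → B, ∑ e : Fin n → E,
      C.codeLaw (codebookCode hPA hJ cb h dj) 0 s a k b e *
      (1 - (codebookCode hPA hJ cb h dj).dec b s (0, k))
      = ∑ j, ∑ b : Fin n → B, ∑ e : Fin n → E,
        (∏ i, C.QS (s i)) / J * (((∏ i, PA (cb s j i) (s i) (a i)) *
        ∏ i, C.W (a i) (s i) (b i, e i)) * if h s j = h s (dj s b) then 0 else 1) := by
    intro a
    rw [Finset.sum_comm]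
    simp_rw [Finset.sum_comm (s := (Finset.univ : Finset (Fin K)))]
    simp_rw [h1]
    simp_rw [Finset.sum_comm (t := (Finset.univ : Finset (Fin J)))]
  simp_rw [h2]
  rw [Finset.sum_comm]
  refine Finset.sum_congr rfl fun j _ => ?_
  rw [Finset.sum_comm]
  refine Finset.sum_congr rfl fun b _ => ?_
  rw [← C.sum_block_bob PA (cb s j) s b]
  simp only [Finset.sum_mul, Finset.mul_sum]

theorem keyWardenLaw_codebookCode :
    C.keyWardenLaw (codebookCode hPA hJ cb h dj)
      = codebookLaw (fun s : Fin n → S => ∏ i, C.QS (s i))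
        (fun u s e => ∏ i, C.wardenLetter PA (u i) (s i) (e i)) cb h := by
  classical
  funext x
  obtain ⟨k, e⟩ := x
  simp only [keyWardenLaw, codebookLaw, Fin.sum_univ_one]
  refine Finset.sum_congr rfl fun s _ => ?_
  have h1 : ∀ (a : Fin n → A) (b : Fin n → B), C.codeLaw (codebookCode hPA hJ cb h dj) 0 s a k b e
      = ∑ j, if h s j = k then (∏ i, C.QS (s i)) / J * ((∏ i, PA (cb s j i) (s i) (a i)) *
        ∏ i, C.W (a i) (s i) (b i, e i)) else 0 := by
    intro a b
    simp only [codeLaw, codebookCode, Finset.mul_sum, Finset.sum_mul]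
    refine Finset.sum_congr rfl fun j _ => ?_
    split_ifs <;> simp
    ring
  simp_rw [h1]
  simp_rw [Finset.sum_comm (t := (Finset.univ : Finset (Fin J)))]
  refine Finset.sum_congr rfl fun j _ => ?_
  rw [← C.sum_block_warden PA (cb s j) s e]
  split_ifs
  · simp only [Finset.mul_sum]
  · simp

end Construction

/-- Rate zero is achieved by imitating the innocent input. -/
theorem zero_mem_achievableKeyRates : (0 : ℝ) ∈ C.achievableKeyRates := by
  have h1 : ∀ (n M K : ℕ), M = 1 → K = 1 → ∃ c : Code S A B n M K,
      C.errorProb c = 0 ∧ tvDist (C.keyWardenLaw c) (C.idealKeyWardenLaw n K) = 0 := by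
    rintro n M K rfl rfl
    refine ⟨codebookCode (U := Unit) (J := 1) (PA := fun _ _ => C.innocent)
      (fun _ _ => C.innocent_mem) le_rfl (fun _ _ _ => ()) (fun _ _ => 0) (fun _ _ => 0), ?_, ?_⟩
    · rw [errorProb_codebookCode]
      simp
    · have : C.keyWardenLaw (codebookCode (U := Unit) (J := 1) (PA := fun _ _ => C.innocent)
          (fun _ _ => C.innocent_mem) le_rfl (fun _ _ _ => ())
            (fun (_ : Fin n → S) _ => (0 : Fin 1)) (fun _ _ => 0)) = C.idealKeyWardenLaw n 1 := by
        classical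
        rw [keyWardenLaw_codebookCode]
        funext x
        obtain ⟨k, e⟩ := x
        simp only [codebookLaw, idealKeyWardenLaw, Fin.sum_univ_one, Subsingleton.elim 0 k,
          if_true, Nat.cast_one, div_one, one_mul, ← Finset.prod_mul_distrib]
        rw [sum_prod_eq_prod_sum fun i s =>
          C.QS s * C.wardenLetter (fun _ _ => C.innocent) () s (e i)]
        refine Finset.prod_congr rfl fun i _ => ?_
        simp only [wardenLetter, wardenInnocent, Finset.mul_sum, mul_assoc]
      rw [this]
      simp [tvDist]
  have hone : ∀ n : ℕ, ⌊(2 : ℝ) ^ ((n : ℝ) * 0)⌋₊ = 1 := fun n => by simp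
  choose c hc1 hc2 using fun n => h1 n _ _ (hone n) (hone n)
  refine ⟨0, le_rfl, le_rfl, c, ?_, ?_⟩
  · simp only [hc1]; exact tendsto_const_nhds
  · simp only [hc2]; exact tendsto_const_nhds

section Block

variable {U : Type*} [Fintype U] {PU : S → U → ℝ} {PA : U → S → A → ℝ}

theorem exists_errorProb_le_thresholdError {n J K : ℕ} (hPA : ∀ u s, PA u s ∈ stdSimplex ℝ A)
    (hJ : 1 ≤ J) (cb : (Fin n → S) → Fin J → Fin n → U) (h : (Fin n → S) → Fin J → Fin K) (θ : ℝ) :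
    ∃ dj, C.errorProb (codebookCode hPA hJ cb h dj)
      ≤ thresholdError (fun s : Fin n → S => ∏ i, C.QS (s i))
        (fun (s : Fin n → S) (u : Fin n → U) => ∏ i, PU (s i) (u i))
        (fun u s (b : Fin n → B) => ∏ i, C.bobLetter PA (u i) (s i) (b i)) θ cb := by
  classical
  have hg : ∀ (s : Fin n → S) (b : Fin n → B), ∃ j₀ : Fin J, ∀ j, (if j₀ = j then (0 : ℝ) else 1) ≤
      (1 - passes (fun (s : Fin n → S) (u : Fin n → U) => ∏ i, PU (s i) (u i))
            (fun u s (b : Fin n → B) => ∏ i, C.bobLetter PA (u i) (s i) (b i)) θ s b (cb s j))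
      + ∑ j' ∈ Finset.univ.erase j,
        passes (fun (s : Fin n → S) (u : Fin n → U) => ∏ i, PU (s i) (u i))
            (fun u s (b : Fin n → B) => ∏ i, C.bobLetter PA (u i) (s i) (b i)) θ s b (cb s j') := by
    intro s b
    refine exists_threshold_decision hJ (g := fun j =>
      passes (fun (s : Fin n → S) (u : Fin n → U) => ∏ i, PU (s i) (u i))
        (fun u s (b : Fin n → B) => ∏ i, C.bobLetter PA (u i) (s i) (b i)) θ s b (cb s j))
      fun j => ?_
    unfold passes
    split_ifs
    exacts [Or.inr rfl, Or.inl rfl]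
  choose dj hdj using hg
  refine ⟨dj, ?_⟩
  rw [errorProb_codebookCode, thresholdError]
  refine Finset.sum_le_sum fun s _ => Finset.sum_le_sum fun j _ => Finset.sum_le_sum fun b _ => ?_
  refine mul_le_mul_of_nonneg_left (mul_le_mul_of_nonneg_left ?_
    (Finset.prod_nonneg fun i _ => (C.bobLetter_mem hPA _ _).1 _))
    (div_nonneg (Finset.prod_nonneg fun i _ => C.QS_mem.1 _) (Nat.cast_nonneg J))
  refine le_trans ?_ ((hdj s b j).trans (le_of_eq ?_))
  · by_cases hj : dj s b = j
    · simp [hj]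
    · rw [if_neg hj]
      split_ifs <;> norm_num
  · congr!

theorem exists_block_code (hPU : ∀ s, PU s ∈ stdSimplex ℝ U)
    (hPA : ∀ u s, PA u s ∈ stdSimplex ℝ A)
    (hQ : ∀ e, C.wardenInnocent e = ∑ s, ∑ u, C.QS s * PU s u * C.wardenLetter PA u s e)
    {n M J K : ℕ} (hM : M = 1) (hJ : 1 ≤ J) (hK : 1 ≤ K) {γ θ : ℝ} (hγ : 0 ≤ γ) (hθ : 0 < θ) :
    ∃ c : Code S A B n M K, C.errorProb c + tvDist (C.keyWardenLaw c) (C.idealKeyWardenLaw n K)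
      ≤ (∑ z : Fin n → U × B × S, (∏ i, C.QS (z i).2.2 * PU (z i).2.2 (z i).1 *
            C.bobLetter PA (z i).1 (z i).2.2 (z i).2.1) *
          (1 - passes (fun (s : Fin n → S) (u : Fin n → U) => ∏ i, PU (s i) (u i))
            (fun u s (b : Fin n → B) => ∏ i, C.bobLetter PA (u i) (s i) (b i)) θ
            (fun i => (z i).2.2) (fun i => (z i).2.1) fun i => (z i).1))
        + (J - 1) / θ
        + (∑ z : Fin n → U × E × S, (∏ i, C.QS (z i).2.2 * PU (z i).2.2 (z i).1 *
            C.wardenLetter PA (z i).1 (z i).2.2 (z i).2.1) *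
          leaks (fun s : Fin n → S => ∏ i, C.QS (s i))
            (fun (u : Fin n → U) s e => ∏ i, C.wardenLetter PA (u i) (s i) (e i))
            (fun e => ∏ i, C.wardenInnocent (e i)) γ
            (fun i => (z i).2.2) (fun i => (z i).1) fun i => (z i).2.1)
        + Real.sqrt (γ * K / J) / 2 := by
  subst hM
  have hQn : ∀ e : Fin n → E, ∏ i, C.wardenInnocent (e i) = ∑ s : Fin n → S, ∑ u : Fin n → U,
      (∏ i, C.QS (s i)) * (∏ i, PU (s i) (u i)) * ∏ i, C.wardenLetter PA (u i) (s i) (e i) := by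
    intro e
    rw [sum_sum_eq_sum_pair fun (s : Fin n → S) (u : Fin n → U) => (∏ i, C.QS (s i)) *
      (∏ i, PU (s i) (u i)) * ∏ i, C.wardenLetter PA (u i) (s i) (e i)]
    simp_rw [← Finset.prod_mul_distrib]
    rw [sum_prod_eq_prod_sum fun i (v : S × U) =>
      C.QS v.1 * PU v.1 v.2 * C.wardenLetter PA v.2 v.1 (e i)]
    simp only [Fintype.sum_prod_type, hQ]
  obtain ⟨cb, h, hle⟩ := exists_codebook (J := J) (K := K)
    (prod_mem_stdSimplex (n := n) fun _ => C.QS_mem)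
    (P := fun (s : Fin n → S) (u : Fin n → U) => ∏ i, PU (s i) (u i))
    (fun s => prod_mem_stdSimplex fun i => hPU (s i))
    (VB := fun u s (b : Fin n → B) => ∏ i, C.bobLetter PA (u i) (s i) (b i))
    (fun u s => prod_mem_stdSimplex fun i => C.bobLetter_mem hPA (u i) (s i))
    (VE := fun u s (e : Fin n → E) => ∏ i, C.wardenLetter PA (u i) (s i) (e i))
    (fun u s => prod_mem_stdSimplex fun i => C.wardenLetter_mem hPA (u i) (s i))
    hQn (prod_mem_stdSimplex fun _ => C.wardenInnocent_mem) hJ hK hγ hθ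
  obtain ⟨dj, herr⟩ := C.exists_errorProb_le_thresholdError (PU := PU) hPA hJ cb h θ
  refine ⟨codebookCode hPA hJ cb h dj, ?_⟩
  rw [keyWardenLaw_codebookCode]
  have htv : tvDist (codebookLaw (fun s : Fin n → S => ∏ i, C.QS (s i))
        (fun u s (e : Fin n → E) => ∏ i, C.wardenLetter PA (u i) (s i) (e i)) cb h)
        (C.idealKeyWardenLaw n K)
      = tvDist (codebookLaw (fun s : Fin n → S => ∏ i, C.QS (s i))
        (fun u s (e : Fin n → E) => ∏ i, C.wardenLetter PA (u i) (s i) (e i)) cb h)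
        (fun x : Fin K × (Fin n → E) => 1 / K * ∏ i, C.wardenInnocent (x.2 i)) := rfl
  rw [htv]
  refine (add_le_add_left herr _).trans (hle.trans (le_of_eq ?_))
  rw [sum_sum_sum_eq_sum_triple fun (s : Fin n → S) (u : Fin n → U) (b : Fin n → B) => _,
    sum_sum_sum_eq_sum_triple fun (s : Fin n → S) (u : Fin n → U) (e : Fin n → E) => _]
  simp only [← Finset.prod_mul_distrib]

end Block

section Density

variable {U : Type*} [Fintype U]

/-- The joint law of auxiliary letter, receiver output and state. -/
def bobJoint (PU : S → U → ℝ) (PA : U → S → A → ℝ) (v : U × B × S) : ℝ :=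
  C.QS v.2.2 * PU v.2.2 v.1 * C.bobLetter PA v.1 v.2.2 v.2.1

/-- The joint law of auxiliary letter, warden output and state. -/
def wardenJoint (PU : S → U → ℝ) (PA : U → S → A → ℝ) (v : U × E × S) : ℝ :=
  C.QS v.2.2 * PU v.2.2 v.1 * C.wardenLetter PA v.1 v.2.2 v.2.1

/-- The law of the receiver output given the state. -/
def bobMean (PU : S → U → ℝ) (PA : U → S → A → ℝ) (v : U × B × S) : ℝ :=
  ∑ u', PU v.2.2 u' * C.bobLetter PA u' v.2.2 v.2.1

variable {PU : S → U → ℝ} {PA : U → S → A → ℝ} {P : S × U × A × B × E → ℝ}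

theorem covertLaw_mem (hPU : ∀ s, PU s ∈ stdSimplex ℝ U) (hPA : ∀ u s, PA u s ∈ stdSimplex ℝ A)
    (hP : ∀ s u a b e, P (s, u, a, b, e) = C.QS s * PU s u * PA u s a * C.W a s (b, e)) :
    P ∈ stdSimplex ℝ (S × U × A × B × E) := by
  refine ⟨fun ω => ?_, ?_⟩
  · rw [hP]
    exact mul_nonneg (mul_nonneg (mul_nonneg (C.QS_mem.1 _) ((hPU _).1 _)) ((hPA _ _).1 _))
      ((C.W_mem _ _).1 _)
  · simp only [Fintype.sum_prod_type, hP]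
    simp_rw [← Finset.mul_sum, C.sum_W, mul_one, ← Finset.mul_sum, (hPA _ _).2, mul_one,
      ← Finset.mul_sum, (hPU _).2, mul_one, C.QS_mem.2]

theorem law_aux_bob_eq
    (hP : ∀ s u a b e, P (s, u, a, b, e) = C.QS s * PU s u * PA u s a * C.W a s (b, e)) :
    law P (fun ω => (ω.2.1, ω.2.2.2.1, ω.1)) = C.bobJoint PU PA := by
  let π : U → S × A → ℝ := fun u x => C.QS x.1 * PU x.1 u * PA u x.1 x.2
  have h := C.law_auxiliary (π := π) hP
  funext ⟨u, b, s⟩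
  rw [C.law_aux_bob_state (π := π) h]
  simp only [π, bobMass, bobJoint, bobLetter, Finset.mul_sum, mul_assoc]

theorem law_aux_warden_eq
    (hP : ∀ s u a b e, P (s, u, a, b, e) = C.QS s * PU s u * PA u s a * C.W a s (b, e)) :
    law P (fun ω => (ω.2.1, ω.2.2.2.2, ω.1)) = C.wardenJoint PU PA := by
  let π : U → S × A → ℝ := fun u x => C.QS x.1 * PU x.1 u * PA u x.1 x.2
  have h := C.law_auxiliary (π := π) hP
  funext ⟨u, e, s⟩
  rw [C.law_aux_warden_state (π := π) h]
  simp only [π, wardenMass, wardenJoint, wardenLetter, Finset.mul_sum, mul_assoc]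

theorem law_bob_state_eq
    (hP : ∀ s u a b e, P (s, u, a, b, e) = C.QS s * PU s u * PA u s a * C.W a s (b, e))
    (u : U) (b : B) (s : S) :
    law P (fun ω => (ω.2.2.2.1, ω.1)) (b, s) = C.QS s * C.bobMean PU PA (u, b, s) := by
  rw [law_eq_sum_law_pair P fun ω => ω.2.1, law_aux_bob_eq C hP, bobMean, Finset.mul_sum]
  simp only [bobJoint, mul_assoc]

theorem wardenInnocent_eq
    (hP : ∀ s u a b e, P (s, u, a, b, e) = C.QS s * PU s u * PA u s a * C.W a s (b, e))
    (hE : law P (fun ω => ω.2.2.2.2) = C.wardenInnocent) (e : E) :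
    C.wardenInnocent e = ∑ s, ∑ u, C.QS s * PU s u * C.wardenLetter PA u s e := by
  rw [← hE, law_eq_sum_law_pair P fun ω => ω.1]
  refine Finset.sum_congr rfl fun s _ => ?_
  rw [law_eq_sum_law_pair P fun ω => ω.2.1]
  refine Finset.sum_congr rfl fun u _ => ?_
  have h := congrFun (C.law_aux_warden_eq hP) (u, e, s)
  rw [wardenJoint] at h
  rw [← h]
  exact law_congr fun ω => by simp only [Prod.mk.injEq]; tauto

theorem bobJoint_pos (hPU : ∀ s, PU s ∈ stdSimplex ℝ U)
    (hPA : ∀ u s, PA u s ∈ stdSimplex ℝ A) {v : U × B × S} (hv : 0 < C.bobJoint PU PA v) :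
    0 < C.QS v.2.2 ∧ 0 < PU v.2.2 v.1 ∧ 0 < C.bobLetter PA v.1 v.2.2 v.2.1 ∧
      0 < C.bobMean PU PA v := by
  have h1 := C.QS_mem.1 v.2.2
  have h2 := (hPU v.2.2).1 v.1
  have h3 := (C.bobLetter_mem hPA v.1 v.2.2).1 v.2.1
  have h1' : 0 < C.QS v.2.2 := h1.lt_of_ne' fun h => by simp [bobJoint, h] at hv
  have h2' : 0 < PU v.2.2 v.1 := h2.lt_of_ne' fun h => by simp [bobJoint, h] at hv
  have h3' : 0 < C.bobLetter PA v.1 v.2.2 v.2.1 :=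
    h3.lt_of_ne' fun h => by simp [bobJoint, h] at hv
  refine ⟨h1', h2', h3', (mul_pos h2' h3').trans_le ?_⟩
  exact Finset.single_le_sum (f := fun u' => PU v.2.2 u' * C.bobLetter PA u' v.2.2 v.2.1)
    (fun u' _ => mul_nonneg ((hPU _).1 _) ((C.bobLetter_mem hPA _ _).1 _)) (Finset.mem_univ v.1)

theorem wardenJoint_pos (hPU : ∀ s, PU s ∈ stdSimplex ℝ U)
    (hPA : ∀ u s, PA u s ∈ stdSimplex ℝ A)
    (hQ : ∀ e, C.wardenInnocent e = ∑ s, ∑ u, C.QS s * PU s u * C.wardenLetter PA u s e)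
    {v : U × E × S} (hv : 0 < C.wardenJoint PU PA v) :
    0 < C.QS v.2.2 ∧ 0 < PU v.2.2 v.1 ∧ 0 < C.wardenLetter PA v.1 v.2.2 v.2.1 ∧
      0 < C.wardenInnocent v.2.1 := by
  have h1 := C.QS_mem.1 v.2.2
  have h2 := (hPU v.2.2).1 v.1
  have h3 := (C.wardenLetter_mem hPA v.1 v.2.2).1 v.2.1
  have h1' : 0 < C.QS v.2.2 := h1.lt_of_ne' fun h => by simp [wardenJoint, h] at hv
  have h2' : 0 < PU v.2.2 v.1 := h2.lt_of_ne' fun h => by simp [wardenJoint, h] at hv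
  have h3' : 0 < C.wardenLetter PA v.1 v.2.2 v.2.1 :=
    h3.lt_of_ne' fun h => by simp [wardenJoint, h] at hv
  refine ⟨h1', h2', h3', hv.trans_le ?_⟩
  have h0 : ∀ s u, 0 ≤ C.QS s * PU s u * C.wardenLetter PA u s v.2.1 := fun s u =>
    mul_nonneg (mul_nonneg (C.QS_mem.1 _) ((hPU _).1 _)) ((C.wardenLetter_mem hPA _ _).1 _)
  rw [hQ]
  exact (Finset.single_le_sum
      (f := fun u => C.QS v.2.2 * PU v.2.2 u * C.wardenLetter PA u v.2.2 v.2.1)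
      (fun u _ => h0 _ u) (Finset.mem_univ v.1)).trans
    (Finset.single_le_sum
      (f := fun s => ∑ u, C.QS s * PU s u * C.wardenLetter PA u s v.2.1)
      (fun s _ => Finset.sum_nonneg fun u _ => h0 s u) (Finset.mem_univ v.2.2))

/-- The single-letter rate is the sum of the mean of the information density of the receiver,
which is `I(U;B|S)`, and of the mean of `log (Q₀(E) / P(E|U,S) Q_S(S))`, which is
`H(S) - I(U,S;E)`. -/
theorem keyRate_eq_sum_density (hPU : ∀ s, PU s ∈ stdSimplex ℝ U)
    (hPA : ∀ u s, PA u s ∈ stdSimplex ℝ A)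
    (hP : ∀ s u a b e, P (s, u, a, b, e) = C.QS s * PU s u * PA u s a * C.W a s (b, e))
    (hE : law P (fun ω => ω.2.2.2.2) = C.wardenInnocent) :
    keyRate P = (∑ v, C.bobJoint PU PA v *
        Real.logb 2 (C.bobLetter PA v.1 v.2.2 v.2.1 / C.bobMean PU PA v))
      + ∑ v, C.wardenJoint PU PA v * Real.logb 2 (C.wardenInnocent v.2.1 /
          (C.wardenLetter PA v.1 v.2.2 v.2.1 * C.QS v.2.2)) := by
  have hmem := C.covertLaw_mem hPU hPA hP
  have hQ := C.wardenInnocent_eq hP hE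
  rw [keyRate_eq_entropies, entropy_eq_sum, entropy_eq_sum, entropy_eq_sum, entropy_eq_sum,
    ← C.law_aux_bob_eq hP, ← C.law_aux_warden_eq hP,
    sum_law_mul P (fun ω => (ω.2.1, ω.2.2.2.1, ω.1)) fun v =>
      Real.logb 2 (C.bobLetter PA v.1 v.2.2 v.2.1 / C.bobMean PU PA v),
    sum_law_mul P (fun ω => (ω.2.1, ω.2.2.2.2, ω.1)) fun v =>
      Real.logb 2 (C.wardenInnocent v.2.1 / (C.wardenLetter PA v.1 v.2.2 v.2.1 * C.QS v.2.2)),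
    ← Finset.sum_add_distrib, ← Finset.sum_neg_distrib, ← Finset.sum_neg_distrib,
    ← Finset.sum_neg_distrib, ← Finset.sum_neg_distrib, ← Finset.sum_sub_distrib,
    ← Finset.sum_add_distrib, ← Finset.sum_sub_distrib]
  refine Finset.sum_congr rfl fun ω _ => ?_
  rcases (hmem.1 ω).eq_or_lt with h0 | h0
  · simp [← h0]
  have hb := le_law hmem.1 (fun ω => (ω.2.1, ω.2.2.2.1, ω.1)) ω
  have hw := le_law hmem.1 (fun ω => (ω.2.1, ω.2.2.2.2, ω.1)) ω
  rw [C.law_aux_bob_eq hP] at hb ⊢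
  rw [C.law_aux_warden_eq hP] at hw ⊢
  obtain ⟨q1, q2, q3, q4⟩ := C.bobJoint_pos hPU hPA (h0.trans_le hb)
  obtain ⟨-, -, q5, q6⟩ := C.wardenJoint_pos hPU hPA hQ (h0.trans_le hw)
  rw [C.law_bob_state_eq hP ω.2.1, hE]
  simp only [bobJoint, wardenJoint]
  dsimp only at q1 q2 q3 q4 q5 q6
  rw [Real.logb_mul (mul_pos q1 q2).ne' q5.ne', Real.logb_mul (mul_pos q1 q2).ne' q3.ne',
    Real.logb_mul q1.ne' q4.ne', Real.logb_div q3.ne' q4.ne',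
    Real.logb_div q6.ne' (mul_pos q5 q1).ne', Real.logb_mul q5.ne' q1.ne']
  ring

/-- Every key rate below a single-letter rate is achieved by random coding with a single
message. -/
theorem mem_achievableKeyRates_of_lt {x RK : ℝ} (hx : x ∈ C.keyRateValues) (hRK : 0 ≤ RK)
    (hlt : RK < x) : RK ∈ C.achievableKeyRates := by
  obtain ⟨N, P, ⟨⟨PU, PA, hPU, hPA, hP⟩, hE⟩, rfl⟩ := hx
  have hmem := C.covertLaw_mem hPU hPA hP
  have hQ := C.wardenInnocent_eq hP hE
  have hw1 : C.bobJoint PU PA ∈ stdSimplex ℝ _ := by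
    rw [← C.law_aux_bob_eq hP]; exact law_mem_stdSimplex hmem _
  have hw2 : C.wardenJoint PU PA ∈ stdSimplex ℝ _ := by
    rw [← C.law_aux_warden_eq hP]; exact law_mem_stdSimplex hmem _
  have hrate := C.keyRate_eq_sum_density hPU hPA hP hE
  -- A quarter of the gap is the margin of each of the two thresholds, of the codebook size below
  -- the decoding threshold, and of the key rate.
  obtain ⟨δ, hδ⟩ : ∃ δ, δ = (keyRate P - RK) / 4 := ⟨_, rfl⟩
  have hδ0 : 0 < δ := by rw [hδ]; linarith
  set x1 : Fin N × B × S → ℝ := fun v => C.bobLetter PA v.1 v.2.2 v.2.1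
  set y1 : Fin N × B × S → ℝ := fun v => C.bobMean PU PA v
  set x2 : Fin N × E × S → ℝ := fun v => C.wardenInnocent v.2.1
  set y2 : Fin N × E × S → ℝ := fun v => C.wardenLetter PA v.1 v.2.2 v.2.1 * C.QS v.2.2
  set μ1 := ∑ v, C.bobJoint PU PA v * Real.logb 2 (x1 v / y1 v)
  set μ2 := ∑ v, C.wardenJoint PU PA v * Real.logb 2 (x2 v / y2 v) with hμ2
  set c1 := ∑ v, C.bobJoint PU PA v * (Real.logb 2 (x1 v / y1 v) - μ1) ^ 2
  set c2 := ∑ v, C.wardenJoint PU PA v * (Real.logb 2 (x2 v / y2 v) - μ2) ^ 2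
  have hone : ∀ n : ℕ, ⌊(2 : ℝ) ^ ((n : ℝ) * 0)⌋₊ = 1 := fun n => by simp
  have hcode : ∀ n : ℕ, ∃ c : Code S A B n ⌊(2 : ℝ) ^ ((n : ℝ) * 0)⌋₊ ⌊(2 : ℝ) ^ ((n : ℝ) * RK)⌋₊,
      n ≠ 0 → C.errorProb c + tvDist (C.keyWardenLaw c) (C.idealKeyWardenLaw n _) ≤
        c1 / δ ^ 2 / n + (2 : ℝ) ^ (-(n * δ)) + c2 / δ ^ 2 / n
          + Real.sqrt ((2 : ℝ) ^ (-(n * δ))) / 2 := by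
    intro n
    -- The summand `1` keeps the codebook nonempty when `μ1` is small; the error bound involves only
    -- `J - 1`.
    obtain ⟨c, hc⟩ := C.exists_block_code hPU hPA hQ (hone n)
      (J := ⌊(2 : ℝ) ^ ((n : ℝ) * (μ1 - 2 * δ))⌋₊ + 1) (by omega) (one_le_floor_two_rpow hRK n)
      (γ := (2 : ℝ) ^ ((n : ℝ) * (δ - μ2))) (θ := (2 : ℝ) ^ ((n : ℝ) * (μ1 - δ)))
      (by positivity) (by positivity)
    refine ⟨c, fun hn => hc.trans ?_⟩
    refine add_le_add (add_le_add (add_le_add ?_ ?_) ?_) ?_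
    · refine sum_prod_ratio_le hw1 (x := x1) (y := y1)
        (fun v hv => (C.bobJoint_pos hPU hPA hv).2.2.1)
        (fun v hv => (C.bobJoint_pos hPU hPA hv).2.2.2) hδ0 hn
        (fun z => sub_le_self _ (passes_nonneg _ _ _ _ _ _)) fun z hz => ?_
      have : ∑ u' : Fin n → Fin N, (∏ i, PU (z i).2.2 (u' i)) *
          ∏ i, C.bobLetter PA (u' i) (z i).2.2 (z i).2.1 = ∏ i, y1 (z i) := by
        simp_rw [← Finset.prod_mul_distrib]
        rw [sum_prod_eq_prod_sum fun i u => PU (z i).2.2 u *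
          C.bobLetter PA u (z i).2.2 (z i).2.1]
        rfl
      rw [passes, this, if_pos hz, sub_self]
    · rw [Nat.cast_add, Nat.cast_one, add_sub_cancel_right, div_le_iff₀ (by positivity),
        ← Real.rpow_add (by norm_num)]
      refine (Nat.floor_le (by positivity)).trans (le_of_eq ?_)
      congr 1
      ring
    · refine sum_prod_ratio_le hw2 (x := x2) (y := y2)
        (fun v hv => (C.wardenJoint_pos hPU hPA hQ hv).2.2.2)
        (fun v hv => mul_pos (C.wardenJoint_pos hPU hPA hQ hv).2.2.1
          (C.wardenJoint_pos hPU hPA hQ hv).1) hδ0 hn (fun z => leaks_le_one _ _ _ _ _ _ _)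
        fun z hz => ?_
      rw [leaks, if_neg]
      rw [not_lt, ← Finset.prod_mul_distrib]
      have h2 := mul_le_mul_of_nonneg_left hz.le
        (by positivity : (0 : ℝ) ≤ (2 : ℝ) ^ ((n : ℝ) * (δ - μ2)))
      rw [← mul_assoc, ← Real.rpow_add (by norm_num), ← mul_add, ← hμ2] at h2
      simpa using h2
    · refine div_le_div_of_nonneg_right (Real.sqrt_le_sqrt ?_) (by norm_num)
      have hJ : (2 : ℝ) ^ ((n : ℝ) * (μ1 - 2 * δ)) ≤
          ((⌊(2 : ℝ) ^ ((n : ℝ) * (μ1 - 2 * δ))⌋₊ + 1 : ℕ) : ℝ) := by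
        push_cast
        exact (Nat.lt_floor_add_one _).le
      have hK : (⌊(2 : ℝ) ^ ((n : ℝ) * RK)⌋₊ : ℝ) ≤ (2 : ℝ) ^ ((n : ℝ) * RK) :=
        Nat.floor_le (by positivity)
      rw [div_le_iff₀ (by positivity)]
      refine (mul_le_mul_of_nonneg_left hK (by positivity)).trans
        (le_trans (le_of_eq ?_) (mul_le_mul_of_nonneg_left hJ (by positivity)))
      rw [← Real.rpow_add (by norm_num), ← Real.rpow_add (by norm_num)]
      congr 1
      have : RK = μ1 + μ2 - 4 * δ := by rw [← hrate, hδ]; ring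
      rw [this]
      ring
  choose c hc using hcode
  have hpow : Tendsto (fun n : ℕ => (2 : ℝ) ^ (-((n : ℝ) * δ))) atTop (𝓝 0) := by
    have h1 : ∀ n : ℕ, (2 : ℝ) ^ (-((n : ℝ) * δ)) = ((2 : ℝ) ^ (-δ)) ^ n := fun n => by
      rw [← Real.rpow_natCast, ← Real.rpow_mul (by norm_num)]
      congr 1
      ring
    simp_rw [h1]
    exact tendsto_pow_atTop_nhds_zero_of_lt_one (by positivity)
      (Real.rpow_lt_one_of_one_lt_of_neg (by norm_num) (by linarith))
  have hlim : Tendsto (fun n : ℕ => c1 / δ ^ 2 / n + (2 : ℝ) ^ (-((n : ℝ) * δ)) + c2 / δ ^ 2 / n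
      + Real.sqrt ((2 : ℝ) ^ (-((n : ℝ) * δ))) / 2) atTop (𝓝 0) := by
    have h1 := ((Real.continuous_sqrt.tendsto 0).comp hpow).div_const 2
    rw [Real.sqrt_zero, zero_div] at h1
    have := (((tendsto_const_div_atTop_nhds_zero_nat (c1 / δ ^ 2)).add hpow).add
      (tendsto_const_div_atTop_nhds_zero_nat (c2 / δ ^ 2))).add h1
    simpa [Function.comp_def] using this
  have htv : ∀ n, 0 ≤ tvDist (C.keyWardenLaw (c n)) (C.idealKeyWardenLaw n _) := fun n =>
    mul_nonneg (by norm_num) (Finset.sum_nonneg fun x _ => abs_nonneg _)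
  refine ⟨0, le_rfl, hRK, c, ?_, ?_⟩
  · refine squeeze_zero' (Eventually.of_forall fun n => C.errorProb_nonneg (c n)) ?_ hlim
    filter_upwards [eventually_ne_atTop 0] with n hn
    linarith [hc n hn, htv n]
  · refine squeeze_zero' (Eventually.of_forall htv) ?_ hlim
    filter_upwards [eventually_ne_atTop 0] with n hn
    linarith [hc n hn, C.errorProb_nonneg (c n)]

end Density

/-- The innocent input, with a trivial auxiliary variable, satisfies the covertness constraint. -/
theorem keyRateValues_nonempty : C.keyRateValues.Nonempty := by
  classical
  let P : S × Fin 1 × A × B × E → ℝ := fun y =>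
    C.QS y.1 * 1 * C.innocent y.2.2.1 * C.W y.2.2.1 y.1 (y.2.2.2.1, y.2.2.2.2)
  refine ⟨_, 1, P, ⟨⟨fun _ _ => 1, fun _ _ => C.innocent, fun _ => ⟨fun _ => zero_le_one, by simp⟩,
    fun _ _ => C.innocent_mem, fun _ _ _ _ _ => rfl⟩, ?_⟩, rfl⟩
  funext e
  simp [law, P, Fintype.sum_prod_type, wardenInnocent]

end StateChannel

end CovertKey

end

theorem theorem3 {S A B E : Type*} [Fintype S] [Fintype A] [Fintype B] [Fintype E]
    (C : CovertKey.StateChannel S A B E) :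
    (C.achievableKeyRates.Nonempty ∧ BddAbove C.achievableKeyRates) ∧
      (C.keyRateValues.Nonempty ∧ BddAbove C.keyRateValues) ∧
      C.covertKeyCapacity = sSup C.keyRateValues := by
  have hne : C.achievableKeyRates.Nonempty := ⟨0, C.zero_mem_achievableKeyRates⟩
  have hle : ∀ x ∈ C.achievableKeyRates, x ≤ sSup C.keyRateValues := fun x ⟨_, hx⟩ =>
    C.le_sSup_of_achievable hx
  have hbdd : BddAbove C.achievableKeyRates := ⟨_, hle⟩
  refine ⟨⟨hne, hbdd⟩, ⟨C.keyRateValues_nonempty, C.bddAbove_keyRateValues⟩,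
    le_antisymm (csSup_le hne hle) (csSup_le C.keyRateValues_nonempty fun x hx => ?_)⟩
  rw [CovertKey.StateChannel.covertKeyCapacity]
  have h0 := le_csSup hbdd C.zero_mem_achievableKeyRates
  by_contra! hlt
  obtain ⟨y, hy1, hy2⟩ := exists_between hlt
  exact absurd (le_csSup hbdd (C.mem_achievableKeyRates_of_lt hx (h0.trans hy1.le) hy2))
    (not_le.2 hy1)
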